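/- Let $G$ be a locally compact (Hausdorff) abelian group with Haar measure $dt$, and let $\omega\ge 1$ be a weight on $G$, i.e. a continuous function $\omega\colon G\to(0,\infty)$ with $\omega(s+t)\le\omega(s)\omega(t)$ for all $s,t\in G$ and $\omega(0)=1$. Let $L^1_\omega(G)$ be the Beurling algebra: the Banach algebra, under convolution, of all (classes of) measurable functions $f$ on $G$ with $\|f\|=\int_G |f(t)|\,\omega(t)\,dt<\infty$. Put $$\omega_1(s)=\limsup_{t\to\infty}\frac{\omega(t+s)}{\omega(t)}=\inf\Big\{\sup_{t\notin K}\frac{\omega(t+s)}{\omega(t)} : K\subseteq G \text{ compact}\Big\}\qquad(s\in G),$$ and let $\sigma_\omega$ be a weight on $G$ for which there are constants $M,N>0$ with $M\omega_1\le\sigma_\omega\le N\omega_1$ on $G$; such a weight exists if $G$ is not compact. (If $G$ is compact, $\sigma_\omega$ may be any weight on $G$.) Suppose that $\sigma_\omega$ is bounded. Then the following are equivalent: (a) there is no non-zero continuous point derivation on $L^1_\omega(G)$ at the augmentation character $\varphi_0(f)=\int_G f(t)\,dt$; that is, every continuous linear functional $d$ on $L^1_\omega(G)$ with $d(f*g)=d(f)\varphi_0(g)+\varphi_0(f)d(g)$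 for all $f,g\in L^1_\omega(G)$ is zero; (b) $L^1_\omega(G)$ is 2-weakly amenable; that is, every bounded derivation from $L^1_\omega(G)$ into its second dual bimodule $L^1_\omega(G)^{**}$ is inner. -/

import Mathlib

open MeasureTheory Filter Topology
open scoped ENNReal NNReal

set_option linter.unusedSectionVars false

/-- A weight on an abelian topological group `G` (written additively): a continuous function
`ω : G → (0, ∞)` with `ω (s + t) ≤ ω s * ω t` and `ω 0 = 1`. -/
structure GroupWeight (G : Type*) [AddCommGroup G] [TopologicalSpace G] where
  /-- The underlying function. -/
  toFun : G → ℝ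
  continuous_toFun : Continuous toFun
  pos' : ∀ t, 0 < toFun t
  map_add_le' : ∀ s t, toFun (s + t) ≤ toFun s * toFun t
  map_zero' : toFun 0 = 1

namespace GroupWeight

variable {G : Type*} [AddCommGroup G] [TopologicalSpace G]

instance : CoeFun (GroupWeight G) (fun _ => G → ℝ) := ⟨GroupWeight.toFun⟩

theorem cont (ω : GroupWeight G) : Continuous fun t => ω t := ω.continuous_toFun

theorem pos (ω : GroupWeight G) (t : G) : 0 < ω t := ω.pos' t

theorem add_le (ω : GroupWeight G) (s t : G) : ω (s + t) ≤ ω s * ω t := ω.map_add_le' s t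

theorem zero (ω : GroupWeight G) : ω 0 = 1 := ω.map_zero'

/-- The function `ω₁ s = limsup_{t → ∞} ω (t + s) / ω t`, where `t → ∞` means that `t` leaves
every compact set; on a non-compact group it is the infimum over the compact sets `K` of
`sup {ω (t + s) / ω t : t ∉ K}`. -/
noncomputable def limsupRatio (ω : GroupWeight G) (s : G) : ℝ :=
  limsup (fun t => ω (t + s) / ω t) (cocompact G)

/-- `σ` is a weight associated with `ω`: a weight with `M ω₁ ≤ σ ≤ N ω₁` for some constants
`M, N > 0`. On a compact group there is no `t → ∞`, so that `ω₁` carries no information (and any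
two weights are comparable); every weight then counts as associated with `ω`. -/
def IsAssociated (ω σ : GroupWeight G) : Prop :=
  NoncompactSpace G → ∃ M N : ℝ, 0 < M ∧ 0 < N ∧
    ∀ t, M * ω.limsupRatio t ≤ σ t ∧ σ t ≤ N * ω.limsupRatio t

section exists_associated

theorem ratio_le (ω : GroupWeight G) (s t : G) : ω (t + s) / ω t ≤ ω s := by
  rw [div_le_iff₀ (ω.pos t), mul_comm]
  exact ω.add_le t s

theorem ratio_pos (ω : GroupWeight G) (s t : G) : 0 < ω (t + s) / ω t :=
  div_pos (ω.pos _) (ω.pos _)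

theorem isBoundedUnder_ratio (ω : GroupWeight G) (s : G) (l : Filter G) :
    IsBoundedUnder (· ≤ ·) l (fun t => ω (t + s) / ω t) :=
  isBoundedUnder_of ⟨ω s, fun t => ω.ratio_le s t⟩

theorem isCoboundedUnder_ratio (ω : GroupWeight G) (s : G) (l : Filter G) [l.NeBot] :
    IsCoboundedUnder (· ≤ ·) l (fun t => ω (t + s) / ω t) :=
  (isBoundedUnder_of ⟨0, fun t => (ω.ratio_pos s t).le⟩ :
    IsBoundedUnder (· ≥ ·) l (fun t => ω (t + s) / ω t)).isCoboundedUnder_le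

theorem limsupRatio_zero [NoncompactSpace G] (ω : GroupWeight G) : ω.limsupRatio 0 = 1 := by
  simp [limsupRatio, div_self (ω.pos _).ne']

theorem limsupRatio_le [NoncompactSpace G] (ω : GroupWeight G) (s : G) :
    ω.limsupRatio s ≤ ω s :=
  limsup_le_of_le (ω.isCoboundedUnder_ratio s _) (Eventually.of_forall fun t => ω.ratio_le s t)

theorem limsupRatio_add_le [NoncompactSpace G] [IsTopologicalAddGroup G] (ω : GroupWeight G)
    (s t : G) : ω.limsupRatio (s + t) ≤ ω.limsupRatio s * ω.limsupRatio t := by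
  have key : ∀ a b : ℝ, ω.limsupRatio s < a → ω.limsupRatio t < b →
      ω.limsupRatio (s + t) ≤ a * b := by
    intro a b ha hb
    have h1 : ∀ᶠ x in cocompact G, ω (x + s) / ω x < a :=
      eventually_lt_of_limsup_lt ha (ω.isBoundedUnder_ratio s _)
    have h2 : ∀ᶠ x in cocompact G, ω (x + t) / ω x < b :=
      eventually_lt_of_limsup_lt hb (ω.isBoundedUnder_ratio t _)
    have h3 : Tendsto (fun x : G => x + s) (cocompact G) (cocompact G) :=
      (Homeomorph.addRight s).isClosedEmbedding.tendsto_cocompact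
    refine limsup_le_of_le (ω.isCoboundedUnder_ratio _ _) ?_
    filter_upwards [h1, h3.eventually h2] with x hx1 hx2
    have e : ω (x + (s + t)) / ω x = (ω (x + s) / ω x) * (ω (x + s + t) / ω (x + s)) := by
      rw [← add_assoc]
      have := (ω.pos x).ne'
      have := (ω.pos (x + s)).ne'
      field_simp
    rw [e]
    exact mul_le_mul hx1.le hx2.le (ω.ratio_pos _ _).le ((ω.ratio_pos _ _).le.trans hx1.le)
  have lim : Tendsto (fun ε : ℝ => (ω.limsupRatio s + ε) * (ω.limsupRatio t + ε)) (𝓝[>] 0)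
      (𝓝 (ω.limsupRatio s * ω.limsupRatio t)) := by
    have : Continuous fun ε : ℝ => (ω.limsupRatio s + ε) * (ω.limsupRatio t + ε) := by fun_prop
    simpa using (this.tendsto 0).mono_left nhdsWithin_le_nhds
  refine ge_of_tendsto lim ?_
  filter_upwards [self_mem_nhdsWithin] with ε hε
  exact key _ _ (lt_add_of_pos_right _ hε) (lt_add_of_pos_right _ hε)

theorem limsupRatio_nonneg [NoncompactSpace G] (ω : GroupWeight G) (s : G) :
    0 ≤ ω.limsupRatio s :=
  le_limsup_of_frequently_le (Frequently.of_forall fun t => (ω.ratio_pos s t).le)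
    (ω.isBoundedUnder_ratio s _)

theorem limsupRatio_pos [NoncompactSpace G] [IsTopologicalAddGroup G] (ω : GroupWeight G)
    (s : G) : 0 < ω.limsupRatio s := by
  refine lt_of_le_of_ne (ω.limsupRatio_nonneg s) fun h => ?_
  have := ω.limsupRatio_add_le s (-s)
  rw [← h, zero_mul, add_neg_cancel, ω.limsupRatio_zero] at this
  linarith

theorem continuous_limsupRatio [NoncompactSpace G] [IsTopologicalAddGroup G]
    (ω : GroupWeight G) : Continuous ω.limsupRatio := by
  rw [continuous_iff_continuousAt]
  intro s
  have hc := ω.cont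
  have up : Tendsto (fun t => ω.limsupRatio s * ω (t - s)) (𝓝 s) (𝓝 (ω.limsupRatio s)) := by
    have : Continuous fun t => ω.limsupRatio s * ω (t - s) := by fun_prop
    simpa [ω.zero] using this.tendsto s
  have lo : Tendsto (fun t => ω.limsupRatio s / ω (s - t)) (𝓝 s) (𝓝 (ω.limsupRatio s)) := by
    have : Continuous fun t => ω.limsupRatio s / ω (s - t) :=
      continuous_const.div (by fun_prop) fun t => (ω.pos _).ne'
    simpa [ω.zero] using this.tendsto s
  refine tendsto_of_tendsto_of_tendsto_of_le_of_le lo up (fun t => ?_) (fun t => ?_)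
  · change ω.limsupRatio s / ω (s - t) ≤ ω.limsupRatio t
    rw [div_le_iff₀ (ω.pos _)]
    calc ω.limsupRatio s = ω.limsupRatio (t + (s - t)) := by congr 1; abel
      _ ≤ ω.limsupRatio t * ω.limsupRatio (s - t) := ω.limsupRatio_add_le _ _
      _ ≤ _ := mul_le_mul_of_nonneg_left (ω.limsupRatio_le _) (ω.limsupRatio_nonneg _)
  · change ω.limsupRatio t ≤ ω.limsupRatio s * ω (t - s)
    calc ω.limsupRatio t = ω.limsupRatio (s + (t - s)) := by congr 1; abel
      _ ≤ ω.limsupRatio s * ω.limsupRatio (t - s) := ω.limsupRatio_add_le _ _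
      _ ≤ _ := mul_le_mul_of_nonneg_left (ω.limsupRatio_le _) (ω.limsupRatio_nonneg _)

/-- Associated weights exist. -/
theorem exists_isAssociated [IsTopologicalAddGroup G] (ω : GroupWeight G) :
    ∃ σ, ω.IsAssociated σ := by
  by_cases h : NoncompactSpace G
  · exact ⟨⟨ω.limsupRatio, ω.continuous_limsupRatio, ω.limsupRatio_pos, ω.limsupRatio_add_le,
      ω.limsupRatio_zero⟩, fun _ => ⟨1, 1, one_pos, one_pos,
      fun t => by simp⟩⟩
  · exact ⟨ω, fun h' => (h h').elim⟩

end exists_associated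

/-- The measure `ω λ`. -/
noncomputable def measure [MeasurableSpace G] (ω : GroupWeight G) (μ : Measure G) : Measure G :=
  μ.withDensity fun t => ENNReal.ofReal (ω t)

theorem measure_ac [MeasurableSpace G] (ω : GroupWeight G) (μ : Measure G) : ω.measure μ ≪ μ :=
  withDensity_absolutelyContinuous _ _

section measure

variable [MeasurableSpace G] [BorelSpace G] (ω : GroupWeight G) (μ : Measure G)

theorem measurable_nn : Measurable fun t => Real.toNNReal (ω t) :=
  ω.cont.measurable.real_toNNReal

theorem ac_measure : μ ≪ ω.measure μ :=
  withDensity_absolutelyContinuous' ω.measurable_nn.coe_nnreal_ennreal.aemeasurable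
    (Eventually.of_forall fun t => by simpa using ω.pos t)

theorem integrable_measure_iff {f : G → ℂ} :
    Integrable f (ω.measure μ) ↔ Integrable (fun t => (ω t : ℂ) * f t) μ := by
  have := integrable_withDensity_iff_integrable_smul (μ := μ) ω.measurable_nn (g := f)
  refine this.trans (integrable_congr (Eventually.of_forall fun t => ?_))
  simp [NNReal.smul_def, Real.coe_toNNReal _ (ω.pos t).le]

theorem integral_measure (f : G → ℝ) : ∫ t, f t ∂(ω.measure μ) = ∫ t, ω t * f t ∂μ := by
  have := integral_withDensity_eq_integral_smul (μ := μ) ω.measurable_nn f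
  refine this.trans (integral_congr_ae (Eventually.of_forall fun t => ?_))
  simp [NNReal.smul_def, Real.coe_toNNReal _ (ω.pos t).le]

end measure

end GroupWeight

/-- The Beurling space `L¹_ω(G)`: classes of functions `f` with `ω f` integrable for the Haar
measure `μ`, with the norm `∫ |f t| ω t dt`. -/
def BeurlingAlgebra {G : Type*} [AddCommGroup G] [TopologicalSpace G] [MeasurableSpace G]
    (ω : GroupWeight G) (μ : Measure G) : Type _ :=
  Lp ℂ 1 (ω.measure μ)

namespace BeurlingAlgebra

variable {G : Type*} [AddCommGroup G] [TopologicalSpace G] [MeasurableSpace G]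
  {ω : GroupWeight G} {μ : Measure G}

noncomputable instance : NormedAddCommGroup (BeurlingAlgebra ω μ) :=
  inferInstanceAs (NormedAddCommGroup (Lp ℂ 1 (ω.measure μ)))

noncomputable instance : NormedSpace ℂ (BeurlingAlgebra ω μ) :=
  inferInstanceAs (NormedSpace ℂ (Lp ℂ 1 (ω.measure μ)))

instance : CompleteSpace (BeurlingAlgebra ω μ) :=
  inferInstanceAs (CompleteSpace (Lp ℂ 1 (ω.measure μ)))

/-- An element of `L¹_ω(G)` as an element of Mathlib's space `L¹(ω λ)`. -/
def toLp (f : BeurlingAlgebra ω μ) : Lp ℂ 1 (ω.measure μ) := f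

/-- A representative of an element of `L¹_ω(G)`. -/
noncomputable instance : CoeFun (BeurlingAlgebra ω μ) (fun _ => G → ℂ) :=
  ⟨fun f => f.toLp⟩

/-- The class of a function in `L¹_ω(G)`. -/
noncomputable def mk (f : G → ℂ) (hf : Integrable f (ω.measure μ)) : BeurlingAlgebra ω μ :=
  (memLp_one_iff_integrable.2 hf).toLp f

variable [BorelSpace G]

theorem coeFn_mk (f : G → ℂ) (hf : Integrable f (ω.measure μ)) : mk f hf =ᵐ[μ] f :=
  (ω.ac_measure μ).ae_le (MemLp.coeFn_toLp (memLp_one_iff_integrable.2 hf))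

theorem integrable (f : BeurlingAlgebra ω μ) : Integrable f (ω.measure μ) :=
  L1.integrable_coeFn f.toLp

theorem integrable_weight_mul (f : BeurlingAlgebra ω μ) :
    Integrable (fun t => (ω t : ℂ) * f t) μ :=
  (ω.integrable_measure_iff μ).1 f.integrable

theorem ext_ae {f g : BeurlingAlgebra ω μ} (h : f =ᵐ[μ] g) : f = g :=
  Lp.ext ((ω.measure_ac μ).ae_le h)

theorem coeFn_add (f g : BeurlingAlgebra ω μ) : ⇑(f + g) =ᵐ[μ] fun t => f t + g t :=
  (ω.ac_measure μ).ae_le (Lp.coeFn_add f.toLp g.toLp)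

theorem coeFn_sub (f g : BeurlingAlgebra ω μ) : ⇑(f - g) =ᵐ[μ] fun t => f t - g t :=
  (ω.ac_measure μ).ae_le (Lp.coeFn_sub f.toLp g.toLp)

theorem coeFn_smul (c : ℂ) (f : BeurlingAlgebra ω μ) : ⇑(c • f) =ᵐ[μ] fun t => c * f t :=
  (ω.ac_measure μ).ae_le (Lp.coeFn_smul c f.toLp)

theorem norm_eq (f : BeurlingAlgebra ω μ) : ‖f‖ = ∫ t, ω t * ‖f t‖ ∂μ :=
  (L1.norm_eq_integral_norm f.toLp).trans (ω.integral_measure μ _)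

theorem integrable_norm (f : BeurlingAlgebra ω μ) : Integrable (fun t => ω t * ‖f t‖) μ := by
  refine f.integrable_weight_mul.norm.congr (Eventually.of_forall fun t => ?_)
  simp [abs_of_pos (ω.pos t)]

section mul

variable [IsTopologicalAddGroup G] [μ.IsAddHaarMeasure]

theorem sub_ae (t : G) {p : G → Prop} (h : ∀ᵐ s ∂μ, p s) : ∀ᵐ s ∂μ, p (s - t) :=
  (measurePreserving_sub_right μ t).quasiMeasurePreserving.ae h

theorem integrable_translate_aux (t : G) (f : BeurlingAlgebra ω μ) :
    Integrable (fun s => ω t * (ω (s - t) * ‖f (s - t)‖)) μ :=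
  (f.integrable_norm.comp_sub_right t).const_mul _

theorem integrable_translate (t : G) (f : BeurlingAlgebra ω μ) :
    Integrable (fun s => f (s - t)) (ω.measure μ) := by
  rw [ω.integrable_measure_iff]
  refine (integrable_translate_aux t f).mono' ?_ (Eventually.of_forall fun s => ?_)
  · refine (Complex.continuous_ofReal.comp ω.cont).measurable.aestronglyMeasurable.mul ?_
    exact (f.integrable.aestronglyMeasurable.mono_ac (ω.ac_measure μ)).comp_quasiMeasurePreserving
        (measurePreserving_sub_right μ t).quasiMeasurePreserving
  · rw [norm_mul, Complex.norm_real, Real.norm_of_nonneg (ω.pos s).le, ← mul_assoc]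
    refine mul_le_mul_of_nonneg_right ?_ (norm_nonneg _)
    have := ω.add_le t (s - t)
    rwa [add_sub_cancel] at this

/-- The translate `s ↦ f (s - t)` of `f`, which is `δ_t * f`. -/
noncomputable def translate (t : G) (f : BeurlingAlgebra ω μ) : BeurlingAlgebra ω μ :=
  mk (fun s => f (s - t)) (integrable_translate t f)

theorem coeFn_translate (t : G) (f : BeurlingAlgebra ω μ) :
    ⇑(translate t f) =ᵐ[μ] fun s => f (s - t) := coeFn_mk _ _

theorem norm_translate_le (t : G) (f : BeurlingAlgebra ω μ) : ‖translate t f‖ ≤ ω t * ‖f‖ := by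
  rw [norm_eq, norm_eq, ← integral_const_mul,
    ← integral_sub_right_eq_self (fun s => ω t * (ω s * ‖f s‖)) t]
  refine integral_mono_ae (translate t f).integrable_norm (integrable_translate_aux t f) ?_
  filter_upwards [coeFn_translate t f] with s hs
  rw [hs, ← mul_assoc]
  refine mul_le_mul_of_nonneg_right ?_ (norm_nonneg _)
  have := ω.add_le t (s - t)
  rwa [add_sub_cancel] at this

theorem translate_add (t : G) (f g : BeurlingAlgebra ω μ) :
    translate t (f + g) = translate t f + translate t g := by
  apply ext_ae
  filter_upwards [coeFn_translate t (f + g), coeFn_translate t f, coeFn_translate t g,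
    coeFn_add (translate t f) (translate t g), sub_ae t (coeFn_add f g)] with s h1 h2 h3 h4 h5
  rw [h1, h4, h2, h3, h5]

theorem translate_smul (t : G) (c : ℂ) (f : BeurlingAlgebra ω μ) :
    translate t (c • f) = c • translate t f := by
  apply ext_ae
  filter_upwards [coeFn_translate t (c • f), coeFn_translate t f,
    coeFn_smul c (translate t f), sub_ae t (coeFn_smul c f)] with s h1 h2 h3 h4
  rw [h1, h3, h2, h4]

/-- Translation as a bounded operator on `L¹_ω(G)`. -/
noncomputable def translateL (t : G) : BeurlingAlgebra ω μ →L[ℂ] BeurlingAlgebra ω μ :=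
  LinearMap.mkContinuous
    { toFun := translate t, map_add' := translate_add t, map_smul' := translate_smul t }
    (ω t) (norm_translate_le t)

theorem translateL_apply (t : G) (f : BeurlingAlgebra ω μ) : translateL t f = translate t f := rfl

theorem translate_translate (s t : G) (f : BeurlingAlgebra ω μ) :
    translate s (translate t f) = translate (s + t) f := by
  apply ext_ae
  filter_upwards [coeFn_translate s (translate t f), coeFn_translate (s + t) f,
    sub_ae s (coeFn_translate t f)] with x h1 h2 h3
  rw [h1, h2, h3]
  congr 1
  abel

variable [LocallyCompactSpace G] [μ.Regular]

theorem tendsto_translate_zero (f : BeurlingAlgebra ω μ) :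
    Tendsto (fun t => translate t f) (𝓝 0) (𝓝 f) := by
  let F : Lp ℂ 1 μ := (memLp_one_iff_integrable.2 f.integrable_weight_mul).toLp _
  have hF : F =ᵐ[μ] fun t => (ω t : ℂ) * f t := MemLp.coeFn_toLp _
  let T : G → Lp ℂ 1 μ := fun t =>
    Lp.compMeasurePreserving (fun s => s - t) (measurePreserving_sub_right μ t) F
  have hT : Tendsto (fun t => ‖T t - F‖) (𝓝 0) (𝓝 0) := by
    let g : C(G, C(G, G)) := (ContinuousMap.mk (fun a : G × G => a.2 - a.1)
      (by fun_prop)).curry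
    have hc : Continuous T :=
      (continuous_const (y := F)).compMeasurePreservingLp g.continuous
        (fun t => measurePreserving_sub_right μ t) ENNReal.one_ne_top
    have h0 : T 0 = F := by
      apply Lp.ext
      refine (Lp.coeFn_compMeasurePreserving F (measurePreserving_sub_right μ 0)).trans ?_
      exact Eventually.of_forall fun s => by simp
    have := (hc.sub (continuous_const (y := F))).norm.tendsto 0
    simpa [h0] using this
  let δ : G → ℝ := fun t => |ω t - 1| + |1 - (ω (-t))⁻¹|
  have hδ : Tendsto δ (𝓝 0) (𝓝 0) := by
    have hc := ω.cont
    have : Continuous δ := by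
      refine ((hc.sub continuous_const).abs).add ((continuous_const.sub ?_).abs)
      exact (hc.comp continuous_neg).inv₀ fun t => (ω.pos _).ne'
    simpa [δ, ω.zero] using this.tendsto 0
  have bound : ∀ t, ‖translate t f - f‖ ≤ ‖T t - F‖ + δ t * ‖f‖ := by
    intro t
    rw [norm_eq, norm_eq f, L1.norm_eq_integral_norm, ← integral_const_mul,
      ← integral_sub_right_eq_self (fun s => δ t * (ω s * ‖f s‖)) t,
      ← integral_add (L1.integrable_coeFn _).norm
        ((f.integrable_norm.comp_sub_right t).const_mul _)]
    refine integral_mono_ae (integrable_norm _) ((L1.integrable_coeFn _).norm.add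
      ((f.integrable_norm.comp_sub_right t).const_mul _)) ?_
    filter_upwards [coeFn_sub (translate t f) f, coeFn_translate t f, hF, sub_ae t hF,
      Lp.coeFn_sub (T t) F,
      Lp.coeFn_compMeasurePreserving F (measurePreserving_sub_right μ t)] with s h1 h2 h3 h4 h5 h6
    have h6' : (T t) s = F (s - t) := h6
    simp only [h1, h2, h5, Pi.sub_apply, h6', h3, h4]
    have hw : |ω s - ω (s - t)| ≤ δ t * ω (s - t) := by
      have p := ω.pos (s - t)
      have q := ω.pos (-t)
      have u : ω s ≤ ω t * ω (s - t) := by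
        have := ω.add_le t (s - t)
        rwa [add_sub_cancel] at this
      have l : (ω (-t))⁻¹ * ω (s - t) ≤ ω s := by
        rw [inv_mul_le_iff₀ q]
        have := ω.add_le (-t) s
        rwa [neg_add_eq_sub] at this
      have a1 := le_abs_self (ω t - 1)
      have a2 := le_abs_self (1 - (ω (-t))⁻¹)
      have b1 := abs_nonneg (ω t - 1)
      have b2 := abs_nonneg (1 - (ω (-t))⁻¹)
      rw [abs_le]
      constructor
      · nlinarith
      · nlinarith
    calc ω s * ‖f (s - t) - f s‖
        = ‖(ω s : ℂ) * (f (s - t) - f s)‖ := by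
          rw [norm_mul, Complex.norm_real, Real.norm_of_nonneg (ω.pos s).le]
      _ = ‖((ω (s - t) : ℂ) * f (s - t) - ω s * f s)
            + ((ω s - ω (s - t) : ℝ) : ℂ) * f (s - t)‖ := by
          congr 1
          push_cast
          ring
      _ ≤ ‖(ω (s - t) : ℂ) * f (s - t) - ω s * f s‖
            + ‖((ω s - ω (s - t) : ℝ) : ℂ) * f (s - t)‖ := norm_add_le _ _
      _ ≤ _ := by
          refine add_le_add le_rfl ?_
          rw [norm_mul, Complex.norm_real, Real.norm_eq_abs, ← mul_assoc]
          exact mul_le_mul_of_nonneg_right hw (norm_nonneg _)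
  rw [tendsto_iff_norm_sub_tendsto_zero]
  have lim : Tendsto (fun t => ‖T t - F‖ + δ t * ‖f‖) (𝓝 0) (𝓝 0) := by
    simpa using hT.add (hδ.mul_const ‖f‖)
  exact squeeze_zero (fun _ => norm_nonneg _) bound lim

theorem continuous_translate (f : BeurlingAlgebra ω μ) : Continuous fun t => translate t f := by
  rw [continuous_iff_continuousAt]
  intro t
  have h1 : Tendsto (fun u : G => u - t) (𝓝 t) (𝓝 0) := by
    have : Continuous fun u : G => u - t := by fun_prop
    simpa using this.tendsto t
  have h2 := ((translateL t).continuous.tendsto f).comp ((tendsto_translate_zero f).comp h1)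
  refine h2.congr fun u => ?_
  simp only [Function.comp, translateL_apply, translate_translate]
  congr 1
  abel

theorem aestronglyMeasurable_smul {E : Type*} [NormedAddCommGroup E] [NormedSpace ℂ E]
    {F : G → ℂ} (hF : Integrable F μ) {h : G → E} (hh : Continuous h) :
    AEStronglyMeasurable (fun t => F t • h t) μ := by
  let F' : G → ℂ := hF.1.mk F
  have hFF' : F =ᵐ[μ] F' := hF.1.ae_eq_mk
  have hF'm : StronglyMeasurable F' := hF.1.stronglyMeasurable_mk
  have hF' : Integrable F' μ := hF.congr hFF'
  let A : ℕ → Set G := fun n => {t | 1 / ((n : ℝ) + 1) ≤ ‖F' t‖}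
  have hA : ∀ n, MeasurableSet (A n) := fun n => measurableSet_le measurable_const
    hF'm.norm.measurable
  have hAt : ∀ n, μ (A n) ≠ ∞ := fun n => (hF'.measure_norm_ge_lt_top (by positivity)).ne
  choose K hKA hKc hKcl hKm using fun p : ℕ × ℕ =>
    (hA p.1).exists_isCompact_isClosed_sdiff_lt (hAt p.1) (ε := ((p.2 : ℝ≥0∞) + 1)⁻¹)
      (ENNReal.inv_ne_zero.2 (by finiteness))
  have hSm : MeasurableSet (⋃ p, K p) := MeasurableSet.iUnion fun p => (hKcl p).measurableSet
  have hnull : ∀ n, μ (A n \ ⋃ p, K p) = 0 := by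
    intro n
    have h0 : Tendsto (fun m : ℕ => ((m : ℝ≥0∞) + 1)⁻¹) atTop (𝓝 0) := by
      have := (tendsto_add_atTop_iff_nat 1).2 ENNReal.tendsto_inv_nat_nhds_zero
      simpa using this
    refine le_antisymm (ge_of_tendsto' h0 fun m => ?_) zero_le
    exact (measure_mono (Set.sdiff_subset_sdiff_right
      (Set.subset_iUnion K (n, m)))).trans (hKm (n, m)).le
  have hS : AEStronglyMeasurable (fun t => F' t • h t) (μ.restrict (⋃ p, K p)) := by
    rw [aestronglyMeasurable_iUnion_iff]
    intro p
    exact hF'm.aestronglyMeasurable.smul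
      (hh.continuousOn.aestronglyMeasurable_of_isCompact (hKc p) (hKcl p).measurableSet)
  refine ((aestronglyMeasurable_indicator_iff hSm).2 hS).congr ?_
  filter_upwards [hFF', measure_eq_zero_iff_ae_notMem.1 (measure_iUnion_null hnull)] with t h1 h2
  by_cases ht : t ∈ ⋃ p, K p
  · rw [Set.indicator_of_mem ht, h1]
  · rw [Set.indicator_of_notMem ht, h1]
    have : F' t = 0 := by
      by_contra hne
      obtain ⟨n, hn⟩ := exists_nat_one_div_lt (norm_pos_iff.2 hne)
      exact h2 (Set.mem_iUnion.2 ⟨n, hn.le, ht⟩)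
    rw [this, zero_smul]

theorem integrable_smul_translate (f g : BeurlingAlgebra ω μ) :
    Integrable (fun t => f t • translate t g) μ := by
  have hm : AEStronglyMeasurable (fun t => f t • translate t g) μ := by
    have hc : Continuous fun t => ((ω t : ℂ)⁻¹) • translate t g := by
      refine Continuous.smul (f := fun t => ((ω t : ℂ)⁻¹)) ?_ (continuous_translate g)
      refine Continuous.inv₀ (Complex.continuous_ofReal.comp ω.cont) fun t => ?_
      simpa using (ω.pos t).ne'
    refine (aestronglyMeasurable_smul f.integrable_weight_mul hc).congr
      (Eventually.of_forall fun t => ?_)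
    have : (ω t : ℂ) ≠ 0 := by simpa using (ω.pos t).ne'
    simp only [smul_smul]
    congr 1
    field_simp
  refine (f.integrable_norm.mul_const ‖g‖).mono' hm (Eventually.of_forall fun t => ?_)
  rw [norm_smul, mul_comm (ω t), mul_assoc]
  exact mul_le_mul_of_nonneg_left (norm_translate_le t g) (norm_nonneg _)

/-- Convolution `(f * g) s = ∫ f t g (s - t) dt`, as the `L¹_ω(G)`-valued Bochner integral
`∫ f t (δ_t * g) dt`. -/
noncomputable instance : Mul (BeurlingAlgebra ω μ) :=
  ⟨fun f g => ∫ t, f t • translate t g ∂μ⟩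

theorem mul_def (f g : BeurlingAlgebra ω μ) : f * g = ∫ t, f t • translate t g ∂μ := rfl

theorem map_mul_eq {E : Type*} [NormedAddCommGroup E] [NormedSpace ℂ E] [CompleteSpace E]
    (L : BeurlingAlgebra ω μ →L[ℂ] E) (f g : BeurlingAlgebra ω μ) :
    L (f * g) = ∫ t, f t • L (translate t g) ∂μ := by
  rw [mul_def, ← L.integral_comp_comm (integrable_smul_translate f g)]
  simp

theorem norm_mul_le' (f g : BeurlingAlgebra ω μ) : ‖f * g‖ ≤ ‖f‖ * ‖g‖ := by
  rw [mul_def, norm_eq f, ← integral_mul_const]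
  refine norm_integral_le_of_norm_le (f.integrable_norm.mul_const _)
    (Eventually.of_forall fun t => ?_)
  rw [norm_smul, mul_comm (ω t), mul_assoc]
  exact mul_le_mul_of_nonneg_left (norm_translate_le t g) (norm_nonneg _)

theorem mul_add' (f g h : BeurlingAlgebra ω μ) : f * (g + h) = f * g + f * h := by
  simp only [mul_def, translate_add, smul_add]
  exact integral_add (integrable_smul_translate f g) (integrable_smul_translate f h)

theorem add_mul' (f g h : BeurlingAlgebra ω μ) : (f + g) * h = f * h + g * h := by
  simp only [mul_def]
  rw [← integral_add (integrable_smul_translate f h) (integrable_smul_translate g h)]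
  refine integral_congr_ae ?_
  filter_upwards [coeFn_add f g] with t ht
  rw [ht, add_smul]

theorem smul_mul' (c : ℂ) (f g : BeurlingAlgebra ω μ) : (c • f) * g = c • (f * g) := by
  simp only [mul_def]
  rw [← integral_smul]
  refine integral_congr_ae ?_
  filter_upwards [coeFn_smul c f] with t ht
  rw [ht, smul_smul]

theorem mul_smul' (c : ℂ) (f g : BeurlingAlgebra ω μ) : f * (c • g) = c • (f * g) := by
  simp only [mul_def, translate_smul]
  rw [← integral_smul]
  exact integral_congr_ae (Eventually.of_forall fun t => smul_comm _ _ _)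

theorem translate_mul (t : G) (f g : BeurlingAlgebra ω μ) :
    translate t f * g = translate t (f * g) := by
  rw [← translateL_apply t (f * g), map_mul_eq, mul_def,
    ← integral_sub_right_eq_self (fun s => f s • translateL t (translate s g)) t]
  refine integral_congr_ae ?_
  filter_upwards [coeFn_translate t f] with s hs
  rw [hs, translateL_apply, translate_translate, add_sub_cancel]

/-- Right multiplication as a bounded operator. -/
noncomputable def mulRightL (h : BeurlingAlgebra ω μ) :
    BeurlingAlgebra ω μ →L[ℂ] BeurlingAlgebra ω μ :=
  LinearMap.mkContinuous
    { toFun := fun f => f * h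
      map_add' := fun f g => add_mul' f g h
      map_smul' := fun c f => smul_mul' c f h }
    ‖h‖ (fun f => (norm_mul_le' f h).trans (mul_comm _ _).le)

theorem mul_assoc' (f g h : BeurlingAlgebra ω μ) : f * g * h = f * (g * h) := by
  change mulRightL h (f * g) = _
  rw [map_mul_eq, mul_def f (g * h)]
  refine integral_congr_ae (Eventually.of_forall fun t => ?_)
  change f t • (translate t g * h) = _
  rw [translate_mul]

/-- Pairing with a function dominated by the weight, as a bounded functional. -/
noncomputable def pairing (φ : G → ℂ) (hφ : Continuous φ) (C : ℝ) (hC : ∀ t, ‖φ t‖ ≤ C * ω t) :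
    BeurlingAlgebra ω μ →L[ℂ] ℂ :=
  have bd : ∀ f : BeurlingAlgebra ω μ, ∀ t, ‖f t * φ t‖ ≤ C * (ω t * ‖f t‖) := fun f t => by
    rw [norm_mul, mul_comm, ← mul_assoc]
    exact mul_le_mul_of_nonneg_right (hC t) (norm_nonneg _)
  have hi : ∀ f : BeurlingAlgebra ω μ, Integrable (fun t => f t * φ t) μ := fun f =>
    (f.integrable_norm.const_mul C).mono'
      ((f.integrable.aestronglyMeasurable.mono_ac (ω.ac_measure μ)).mul
        hφ.measurable.aestronglyMeasurable) (Eventually.of_forall (bd f))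
  LinearMap.mkContinuous
    { toFun := fun f => ∫ t, f t * φ t ∂μ
      map_add' := fun f g => by
        rw [← integral_add (hi f) (hi g)]
        refine integral_congr_ae ?_
        filter_upwards [coeFn_add f g] with t ht
        rw [ht, add_mul]
      map_smul' := fun c f => by
        rw [RingHom.id_apply, smul_eq_mul, ← integral_const_mul]
        refine integral_congr_ae ?_
        filter_upwards [coeFn_smul c f] with t ht
        rw [ht, mul_assoc] }
    C (fun f => by
      rw [norm_eq f, ← integral_const_mul]
      exact norm_integral_le_of_norm_le (f.integrable_norm.const_mul C)
        (Eventually.of_forall (bd f)))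

/-- The product is the usual convolution: `∫ (f * g) φ = ∫ ∫ f t g s φ (t + s) ds dt` for every
continuous `φ` dominated by the weight (in particular for `φ` continuous with compact
support, and these determine `f * g`). -/
theorem integral_mul_eq (f g : BeurlingAlgebra ω μ) (φ : G → ℂ) (hφ : Continuous φ) (C : ℝ)
    (hC : ∀ t, ‖φ t‖ ≤ C * ω t) :
    ∫ s, (f * g) s * φ s ∂μ = ∫ t, f t * ∫ s, g s * φ (t + s) ∂μ ∂μ := by
  change pairing φ hφ C hC (f * g) = _
  rw [map_mul_eq]
  refine integral_congr_ae (Eventually.of_forall fun t => ?_)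
  change f t * (∫ s, (translate t g) s * φ s ∂μ) = _
  congr 1
  rw [← integral_sub_right_eq_self (fun s => g s * φ (t + s)) t]
  refine integral_congr_ae ?_
  filter_upwards [coeFn_translate t g] with s hs
  rw [hs, add_sub_cancel]

noncomputable instance : NonUnitalNormedRing (BeurlingAlgebra ω μ) :=
  { (inferInstance : NormedAddCommGroup (BeurlingAlgebra ω μ)),
    (inferInstance : Mul (BeurlingAlgebra ω μ)) with
    left_distrib := mul_add'
    right_distrib := add_mul'
    zero_mul := fun f => by simpa using smul_mul' (0 : ℂ) f f
    mul_zero := fun f => by simpa using mul_smul' (0 : ℂ) f f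
    mul_assoc := mul_assoc'
    norm_mul_le := norm_mul_le' }

instance : IsScalarTower ℂ (BeurlingAlgebra ω μ) (BeurlingAlgebra ω μ) :=
  ⟨fun c f g => smul_mul' c f g⟩

instance : SMulCommClass ℂ (BeurlingAlgebra ω μ) (BeurlingAlgebra ω μ) :=
  ⟨fun c f g => (mul_smul' c f g).symm⟩

end mul

/-- The augmentation character `f ↦ ∫ f t dt` of `L¹_ω(G)`, for a weight `ω ≥ 1`. -/
noncomputable def augmentation (f : BeurlingAlgebra ω μ) : ℂ := ∫ t, f t ∂μ

end BeurlingAlgebra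

section BanachAlgebra

variable {A : Type*} [NonUnitalNormedRing A] [NormedSpace ℂ A] [IsScalarTower ℂ A A]
  [SMulCommClass ℂ A A]

/-- A point derivation at `φ`. -/
def IsPointDerivation (φ : A → ℂ) (d : A →L[ℂ] ℂ) : Prop :=
  ∀ a b, d (a * b) = d a * φ b + φ a * d b

/-- The dual module: `(a · F) b = F (b * a)`. -/
noncomputable def dualLeft (a : A) : StrongDual ℂ A →L[ℂ] StrongDual ℂ A :=
  ContinuousLinearMap.precomp ℂ ((ContinuousLinearMap.mul ℂ A).flip a)

/-- The dual module: `(F · a) b = F (a * b)`. -/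
noncomputable def dualRight (a : A) : StrongDual ℂ A →L[ℂ] StrongDual ℂ A :=
  ContinuousLinearMap.precomp ℂ (ContinuousLinearMap.mul ℂ A a)

/-- The second dual module: `(a · Φ) F = Φ (F · a)`. -/
noncomputable def bidualLeft (a : A) :
    StrongDual ℂ (StrongDual ℂ A) →L[ℂ] StrongDual ℂ (StrongDual ℂ A) :=
  ContinuousLinearMap.precomp ℂ (dualRight a)

/-- The second dual module: `(Φ · a) F = Φ (a · F)`. -/
noncomputable def bidualRight (a : A) :
    StrongDual ℂ (StrongDual ℂ A) →L[ℂ] StrongDual ℂ (StrongDual ℂ A) :=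
  ContinuousLinearMap.precomp ℂ (dualLeft a)

variable (A) in
/-- `A` is 2-weakly amenable: every bounded derivation from `A` into its second dual is inner. -/
def IsTwoWeaklyAmenable : Prop :=
  ∀ D : A →L[ℂ] StrongDual ℂ (StrongDual ℂ A),
    (∀ a b, D (a * b) = bidualLeft a (D b) + bidualRight b (D a)) →
      ∃ Φ, ∀ a, D a = bidualLeft a Φ - bidualRight a Φ

end BanachAlgebra

/-!
Convolution is commutative, so both dual modules are symmetric, an inner derivation into the second
dual is zero, and 2-weak amenability says that every bounded derivation `D : A → A**` vanishes.
Two facts carry the proof. Continuous point derivations at the augmentation character are the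
functionals `f ↦ ∫ f p` for continuous additive `p : G → ℂ` with `|p| ≤ C ω`
(`BeurlingAlgebra.isPointDerivation_pairing`, `BeurlingAlgebra.exists_additive_of_isPointDerivation`).
The boundedness of the associated weight says that `ω (t + s) ≤ C ω t` for `t` off a compact set
depending on `s`, with `C` independent of `s` (`GroupWeight.IsAssociated.exists_ratio_le`).

From a point derivation to a derivation. Let `p` be additive and dominated by `ω`. The limit `Θ`
in `A**` of normalized translates `ω(t)⁻¹ δ_t * f`, along an ultrafilter finer than `t → ∞` (any
ultrafilter if `G` is compact), has a bounded orbit under translation. So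
`f ↦ ∫ f s p s (δ_s * e · Θ) ds` is a bounded operator into `A**`, and it is a derivation since `δ_s ↦ p s δ_s` is one (`BeurlingAlgebra.additiveOperator_mul`).
If it vanishes then so does `p`, because `Θ` can be chosen such that no `δ_s * e · Θ` is zero.

From derivations to point derivations. Extending a derivation `D` to point masses makes
`s ↦ δ_{-s} · D δ_s` additive; without the extension this is the function `defect D a F`, additive
when `a` is a product. It is dominated by `ω`, hence zero, if the translates of `F ∈ A*` are bounded,
for instance if `F` lives on a compact set. For general `F` and fixed `s`, subtract from `F` its part
on a large compact set, which does not change the defect; the translate by `-s` of what remains has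
norm at most `C ‖F‖`. So the defect of `F` is dominated by `ω` too, and vanishes
(`BeurlingAlgebra.defect_mul_eq_zero`). Hence `D` commutes with translations in the weak sense, which
makes it zero on products of four elements, and these are dense by the approximate identities.

As `μ` need not be σ-finite, Fubini's theorem is used for continuous functions with compact support
only; elsewhere exchanges of integrals are the continuity of suitable functionals on `A`.
-/

/-! ### Compactly supported functions and approximate identities -/

/-- Density of the continuous functions with compact support in `L^p`. Unlike in
`MeasureTheory.MemLp.exists_hasCompactSupport_eLpNorm_sub_le` the space is not assumed to be normal:
Urysohn's lemma is applied to compact sets only. -/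
theorem exists_hasCompactSupport_eLpNorm_sub_le {α E : Type*} [TopologicalSpace α] [T2Space α]
    [LocallyCompactSpace α] [MeasurableSpace α] [BorelSpace α] [NormedAddCommGroup E]
    [NormedSpace ℝ E] {μ : Measure α} [μ.Regular] {p : ℝ≥0∞} (hp : p ≠ ∞) {f : α → E}
    (hf : MemLp f p μ) {ε : ℝ≥0∞} (hε : ε ≠ 0) :
    ∃ g : α → E, eLpNorm (f - g) p μ ≤ ε ∧ Continuous g ∧ HasCompactSupport g := by
  suffices H : ∃ g : α → E, eLpNorm (f - g) p μ ≤ ε ∧ Continuous g ∧ HasCompactSupport g ∧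
      AEStronglyMeasurable g μ by
    obtain ⟨g, h1, h2, h3, -⟩ := H
    exact ⟨g, h1, h2, h3⟩
  refine hf.induction_dense hp
    (fun g => Continuous g ∧ HasCompactSupport g ∧ AEStronglyMeasurable g μ) ?_ ?_ ?_ hε
  · intro c t ht htμ ε hε
    obtain ⟨δ, δpos, hδ⟩ := exists_Lp_half E μ p hε
    obtain ⟨η, ηpos, hη⟩ := exists_eLpNorm_indicator_le (μ := μ) hp c δpos.ne'
    have hη0 : (η : ℝ≥0∞) ≠ 0 := by simpa using ηpos.ne'
    obtain ⟨s, st, sc, scl, hs⟩ := ht.exists_isCompact_isClosed_sdiff_lt htμ.ne hη0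
    have hsμ : μ s ≠ ∞ := ((measure_mono st).trans_lt htμ).ne
    obtain ⟨V, sV, V_open, -, hV⟩ := scl.measurableSet.exists_isOpen_sdiff_lt hsμ hη0
    obtain ⟨g, g1, g0, gc, hg⟩ := exists_continuous_one_zero_of_isCompact sc
      V_open.isClosed_compl (Set.disjoint_compl_right_iff_subset.2 sV)
    have hcont : Continuous fun x => g x • c := by fun_prop
    have hcs : HasCompactSupport fun x => g x • c := gc.smul_right
    have hm : AEStronglyMeasurable (fun x => g x • c) μ :=
      g.continuous.aestronglyMeasurable.smul_const c
    refine ⟨_, ?_, hcont, hcs, hm⟩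
    have h1 : eLpNorm ((fun x => g x • c) - s.indicator fun _ => c) p μ ≤ δ := by
      refine (eLpNorm_mono fun x => ?_).trans (hη (V \ s) hV.le)
      by_cases hxs : x ∈ s
      · simp [g1 hxs, hxs]
      by_cases hxV : x ∈ V
      · have : ‖g x • c‖ ≤ ‖c‖ := by
          rw [norm_smul, Real.norm_of_nonneg (hg x).1]
          exact mul_le_of_le_one_left (norm_nonneg _) (hg x).2
        simpa [hxs, hxV] using this
      · have : g x = 0 := g0 hxV
        simp [hxs, this]
    have h2 : eLpNorm ((s.indicator fun _ => c) - t.indicator fun _ => c) p μ ≤ δ := by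
      rw [← eLpNorm_neg, neg_sub, ← Set.indicator_sdiff st]
      exact hη _ hs.le
    have hms : AEStronglyMeasurable (s.indicator fun _ => c) μ :=
      aestronglyMeasurable_const.indicator scl.measurableSet
    have := hδ _ _ (hm.sub hms) (hms.sub (aestronglyMeasurable_const.indicator ht)) h1 h2
    rw [sub_add_sub_cancel] at this
    exact this.le
  · rintro f g ⟨hf1, hf2, hf3⟩ ⟨hg1, hg2, hg3⟩
    exact ⟨hf1.add hg1, hf2.add hg2, hf3.add hg3⟩
  · exact fun f h => h.2.2

namespace BeurlingAlgebra

variable {G : Type*} [AddCommGroup G] [TopologicalSpace G] [MeasurableSpace G] [BorelSpace G]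
  {ω : GroupWeight G} {μ : Measure G}

theorem pairing_apply (φ : G → ℂ) (hφ : Continuous φ) (C : ℝ) (hC : ∀ t, ‖φ t‖ ≤ C * ω t)
    (f : BeurlingAlgebra ω μ) : pairing φ hφ C hC f = ∫ t, f t * φ t ∂μ := rfl

theorem norm_pairing_le (φ : G → ℂ) (hφ : Continuous φ) (C : ℝ) (hC : ∀ t, ‖φ t‖ ≤ C * ω t)
    (hC0 : 0 ≤ C) : ‖(pairing φ hφ C hC : BeurlingAlgebra ω μ →L[ℂ] ℂ)‖ ≤ C :=
  ContinuousLinearMap.opNorm_le_bound _ hC0 fun f => by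
    rw [pairing_apply, norm_eq f, ← integral_const_mul]
    refine norm_integral_le_of_norm_le (f.integrable_norm.const_mul C)
      (Eventually.of_forall fun t => ?_)
    rw [norm_mul, mul_comm, ← mul_assoc]
    exact mul_le_mul_of_nonneg_right (hC t) (norm_nonneg _)

theorem integrable_of_hasCompactSupport [IsFiniteMeasureOnCompacts μ] {g : G → ℂ}
    (hg : Continuous g) (hc : HasCompactSupport g) : Integrable g (ω.measure μ) := by
  rw [ω.integrable_measure_iff]
  exact ((Complex.continuous_ofReal.comp ω.cont).mul hg).integrable_of_hasCompactSupport
    hc.mul_left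

theorem norm_mk (f : G → ℂ) (hf : Integrable f (ω.measure μ)) :
    ‖mk f hf‖ = ∫ t, ω t * ‖f t‖ ∂μ := by
  rw [norm_eq]
  refine integral_congr_ae ?_
  filter_upwards [coeFn_mk f hf] with t ht
  rw [ht]

theorem exists_hasCompactSupport_norm_sub_lt [T2Space G] [LocallyCompactSpace G]
    [μ.Regular] (f : BeurlingAlgebra ω μ) {ε : ℝ} (hε : 0 < ε) :
    ∃ (g : G → ℂ) (hg : Continuous g) (hc : HasCompactSupport g),
      ‖f - mk g (integrable_of_hasCompactSupport hg hc)‖ < ε := by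
  obtain ⟨h, hle, hcont, hc⟩ := exists_hasCompactSupport_eLpNorm_sub_le ENNReal.one_ne_top
    (memLp_one_iff_integrable.2 f.integrable_weight_mul)
    (ENNReal.ofReal_pos.2 (half_pos hε)).ne'
  have hω : ∀ t, (ω t : ℂ) ≠ 0 := fun t => by simpa using (ω.pos t).ne'
  have hg : Continuous fun t => (ω t : ℂ)⁻¹ * h t :=
    ((Complex.continuous_ofReal.comp ω.cont).inv₀ hω).mul hcont
  refine ⟨_, hg, hc.mul_left, lt_of_le_of_lt ?_ (half_lt_self hε)⟩
  rw [eLpNorm_one_eq_lintegral_enorm] at hle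
  refine le_trans (le_of_eq ?_) (ENNReal.toReal_le_of_le_ofReal (half_pos hε).le hle)
  rw [← integral_norm_eq_lintegral_enorm ((f.integrable_weight_mul.sub
    (hcont.integrable_of_hasCompactSupport hc)).aestronglyMeasurable)]
  rw [norm_eq]
  refine integral_congr_ae ?_
  filter_upwards [coeFn_sub f (mk _ (integrable_of_hasCompactSupport (ω := ω) hg hc.mul_left)),
    coeFn_mk _ (integrable_of_hasCompactSupport (ω := ω) (μ := μ) hg hc.mul_left)] with t h1 h2
  rw [h1, h2, Pi.sub_apply]
  have e : (ω t : ℂ) * f t - h t = ω t * (f t - (ω t : ℂ)⁻¹ * h t) := by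
    have := hω t
    field_simp
  rw [e, norm_mul, Complex.norm_real, Real.norm_of_nonneg (ω.pos t).le]

/-- Continuous functions dominated by the weight separate the points of `L¹_ω(G)`. -/
theorem eq_zero_of_forall_integral_mul_eq_zero [T2Space G] [LocallyCompactSpace G]
    [μ.Regular] (f : BeurlingAlgebra ω μ)
    (hf : ∀ φ : G → ℂ, Continuous φ → (∀ t, ‖φ t‖ ≤ ω t) → ∫ t, f t * φ t ∂μ = 0) : f = 0 := by
  rw [← norm_le_zero_iff]
  refine le_of_forall_pos_le_add fun ε hε => ?_
  obtain ⟨g, hg, hc, hlt⟩ := exists_hasCompactSupport_norm_sub_lt f (show 0 < ε / 4 by positivity)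
  set h := mk g (integrable_of_hasCompactSupport (ω := ω) (μ := μ) hg hc) with hh
  set M := ∫ t in tsupport g, ω t ∂μ with hM
  have hM0 : 0 ≤ M := integral_nonneg fun t => (ω.pos t).le
  have hMi : IntegrableOn (fun t => ω t) (tsupport g) μ := ω.cont.continuousOn.integrableOn_compact hc
  -- a continuous substitute for the weight times the conjugate phase of `g`
  set δ := ε / (4 * (M + 1)) with hδ
  have hδ0 : 0 < δ := by positivity
  have hden : ∀ t, 0 < ‖g t‖ + δ := fun t => by positivity
  let φ : G → ℂ := fun t => ((ω t / (‖g t‖ + δ) : ℝ) : ℂ) * (starRingEnd ℂ) (g t)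
  have hφ : Continuous φ := by
    have : Continuous fun t => ω t / (‖g t‖ + δ) :=
      ω.cont.div (by fun_prop) fun t => (hden t).ne'
    exact (Complex.continuous_ofReal.comp this).mul (Complex.continuous_conj.comp hg)
  have hφω : ∀ t, ‖φ t‖ ≤ 1 * ω t := fun t => by
    have := ω.pos t
    have := hden t
    simp only [φ, norm_mul, Complex.norm_real, RCLike.norm_conj]
    rw [Real.norm_of_nonneg (by positivity), div_mul_eq_mul_div, div_le_iff₀ this, one_mul]
    gcongr
    linarith
  have h1 : ‖pairing φ hφ 1 hφω h‖ ≤ ε / 4 := by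
    have e : pairing φ hφ 1 hφω h = - pairing φ hφ 1 hφω (f - h) := by
      have : pairing φ hφ 1 hφω f = 0 := hf φ hφ fun t => by simpa using hφω t
      rw [map_sub, this]
      ring
    rw [e, norm_neg]
    refine ((pairing φ hφ 1 hφω).le_of_opNorm_le (norm_pairing_le φ hφ 1 hφω zero_le_one) _).trans ?_
    simpa using hlt.le
  have hval : ∀ t, g t * φ t = ((ω t * ‖g t‖ ^ 2 / (‖g t‖ + δ) : ℝ) : ℂ) := fun t => by
    simp only [φ]
    rw [mul_left_comm, Complex.mul_conj, ← Complex.ofReal_mul, Complex.normSq_eq_norm_sq]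
    congr 1
    ring
  have h2 : pairing φ hφ 1 hφω h = ((∫ t, ω t * ‖g t‖ ^ 2 / (‖g t‖ + δ) ∂μ : ℝ) : ℂ) := by
    rw [pairing_apply, ← integral_complex_ofReal]
    refine integral_congr_ae ?_
    filter_upwards [coeFn_mk g (integrable_of_hasCompactSupport (ω := ω) (μ := μ) hg hc)] with t ht
    rw [hh, ht, hval]
  have hi : Integrable (fun t => ω t * ‖g t‖ ^ 2 / (‖g t‖ + δ)) μ := by
    refine Continuous.integrable_of_hasCompactSupport
      ((ω.cont.mul (by fun_prop)).div (by fun_prop) fun t => (hden t).ne') ?_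
    refine hc.mono fun t ht => ?_
    contrapose! ht
    simp [Function.notMem_support.1 ht]
  have h3 : ‖h‖ ≤ (∫ t, ω t * ‖g t‖ ^ 2 / (‖g t‖ + δ) ∂μ) + δ * M := by
    rw [hh, norm_mk, hM, ← integral_indicator (isClosed_tsupport g).measurableSet,
      ← integral_const_mul, ← integral_add hi
        ((hMi.integrable_indicator (isClosed_tsupport g).measurableSet).const_mul δ)]
    refine integral_mono ?_ (hi.add
      ((hMi.integrable_indicator (isClosed_tsupport g).measurableSet).const_mul δ)) fun t => ?_
    · exact (ω.cont.mul hg.norm).integrable_of_hasCompactSupport hc.norm.mul_left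
    · have p := ω.pos t
      have q := hden t
      by_cases ht : t ∈ tsupport g
      · simp only [Set.indicator_of_mem ht]
        rw [← sub_nonneg]
        have : ω t * ‖g t‖ ^ 2 / (‖g t‖ + δ) + δ * ω t - ω t * ‖g t‖ =
            ω t * δ ^ 2 / (‖g t‖ + δ) := by
          field_simp
          ring
        rw [this]
        positivity
      · simp [Set.indicator_of_notMem ht, image_eq_zero_of_notMem_tsupport ht]
  have h4 : (∫ t, ω t * ‖g t‖ ^ 2 / (‖g t‖ + δ) ∂μ) ≤ ε / 4 := by
    rw [h2, Complex.norm_real] at h1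
    exact (le_abs_self _).trans h1
  have h5 : δ * M ≤ ε / 4 := by
    rw [hδ, div_mul_eq_mul_div, div_le_div_iff₀ (by positivity) (by norm_num)]
    nlinarith
  have h6 : ‖f‖ ≤ ‖f - h‖ + ‖h‖ := by simpa using norm_add_le (f - h) h
  linarith

section group

variable [IsTopologicalAddGroup G] [LocallyCompactSpace G] [T2Space G] [μ.IsAddHaarMeasure]

/-- A non-negative continuous function of integral `1` with compact support inside a given
neighbourhood of `0`. -/
theorem exists_bump {U : Set G} (hU : U ∈ 𝓝 (0 : G)) :
    ∃ g : G → ℝ, Continuous g ∧ HasCompactSupport g ∧ (∀ t, 0 ≤ g t) ∧ (∀ t ∉ U, g t = 0) ∧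
      ∫ t, g t ∂μ = 1 := by
  obtain ⟨V, hVU, hV, h0⟩ := mem_nhds_iff.1 hU
  obtain ⟨f, hf1, hf0, hfc, hf⟩ := exists_continuous_one_zero_of_isCompact
    (isCompact_singleton (x := (0 : G))) hV.isClosed_compl (by simpa using h0)
  have hpos : 0 < ∫ t, f t ∂μ :=
    f.continuous.integral_pos_of_hasCompactSupport_nonneg_nonzero hfc (fun t => (hf t).1)
      (x := 0) (by simp [hf1 (Set.mem_singleton _)])
  refine ⟨fun t => (∫ t, f t ∂μ)⁻¹ * f t, by fun_prop, hfc.mul_left, fun t => ?_, fun t ht => ?_, ?_⟩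
  · exact mul_nonneg (inv_nonneg.2 hpos.le) (hf t).1
  · have : f t = 0 := hf0 fun h => ht (hVU h)
    simp [this]
  · rw [integral_const_mul, inv_mul_cancel₀ hpos.ne']

variable [μ.Regular]

theorem exists_norm_mul_sub_lt (f : BeurlingAlgebra ω μ) {ε : ℝ} (hε : 0 < ε) :
    ∃ e : BeurlingAlgebra ω μ, ‖e * f - f‖ < ε := by
  have hU : {t : G | ‖translate t f - f‖ < ε / 2} ∈ 𝓝 (0 : G) := by
    have := ((tendsto_translate_zero f).sub_const f).norm
    rw [sub_self, norm_zero] at this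
    exact this.eventually (gt_mem_nhds (half_pos hε))
  obtain ⟨g, hg, hgc, hg0, hgU, hg1⟩ := exists_bump (μ := μ) hU
  have hgc' : HasCompactSupport fun t => (g t : ℂ) := hgc.comp_left (g := ((↑) : ℝ → ℂ)) (by simp)
  have hgi := integrable_of_hasCompactSupport (ω := ω) (μ := μ)
    (Complex.continuous_ofReal.comp hg) hgc'
  have hgi' : Integrable (fun t => (g t : ℂ)) μ :=
    (Complex.continuous_ofReal.comp hg).integrable_of_hasCompactSupport hgc'
  set e := mk _ hgi with he
  refine ⟨e, lt_of_le_of_lt ?_ (half_lt_self hε)⟩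
  have h1 : e * f = ∫ t, (g t : ℂ) • translate t f ∂μ := by
    rw [mul_def]
    refine integral_congr_ae ?_
    filter_upwards [coeFn_mk _ hgi] with t ht
    rw [he, ht]
    rfl
  have h2 : f = ∫ t, (g t : ℂ) • f ∂μ := by
    rw [integral_smul_const, integral_complex_ofReal, hg1]
    simp
  have hi1 : Integrable (fun t => (g t : ℂ) • translate t f) μ := by
    refine (integrable_smul_translate e f).congr ?_
    filter_upwards [coeFn_mk _ hgi] with t ht
    rw [he, ht]
    rfl
  have h3 : e * f - f = ∫ t, (g t : ℂ) • (translate t f - f) ∂μ := by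
    conv_lhs => rw [h1]; rhs; rw [h2]
    rw [← integral_sub hi1 (hgi'.smul_const f)]
    simp only [smul_sub]
  rw [h3]
  calc _ ≤ ∫ t, g t * (ε / 2) ∂μ := by
        refine norm_integral_le_of_norm_le
          ((hg.integrable_of_hasCompactSupport hgc).mul_const _) (Eventually.of_forall fun t => ?_)
        rw [norm_smul, Complex.norm_real, Real.norm_of_nonneg (hg0 t)]
        by_cases ht : t ∈ {t : G | ‖translate t f - f‖ < ε / 2}
        · exact mul_le_mul_of_nonneg_left (le_of_lt ht) (hg0 t)
        · simp [hgU t ht]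
    _ = ε / 2 := by rw [integral_mul_const, hg1, one_mul]

/-- A continuous map that vanishes on all products vanishes. -/
theorem eq_zero_of_forall_mul {E : Type*} [TopologicalSpace E] [T2Space E] [Zero E]
    {L : BeurlingAlgebra ω μ → E} (hL : Continuous L) (h : ∀ f g, L (f * g) = 0)
    (f : BeurlingAlgebra ω μ) : L f = 0 := by
  have hcl : IsClosed {g | L g = 0} := isClosed_eq hL continuous_const
  have : f ∈ closure {g | L g = 0} := Metric.mem_closure_iff.2 fun ε hε => by
    obtain ⟨e, he⟩ := exists_norm_mul_sub_lt f hε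
    exact ⟨e * f, h e f, by rwa [dist_comm, dist_eq_norm]⟩
  rwa [hcl.closure_eq] at this

theorem mul_comm_of_hasCompactSupport {f g : G → ℂ} (hf : Continuous f)
    (hfc : HasCompactSupport f) (hg : Continuous g) (hgc : HasCompactSupport g) :
    (mk f (integrable_of_hasCompactSupport hf hfc) : BeurlingAlgebra ω μ) *
        mk g (integrable_of_hasCompactSupport hg hgc) =
      mk g (integrable_of_hasCompactSupport hg hgc) *
        mk f (integrable_of_hasCompactSupport hf hfc) := by
  have key : ∀ {f g : G → ℂ} (hf : Continuous f) (hfc : HasCompactSupport f) (hg : Continuous g)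
      (hgc : HasCompactSupport g) (φ : G → ℂ) (hφ : Continuous φ) (hφω : ∀ t, ‖φ t‖ ≤ 1 * ω t),
      pairing φ hφ 1 hφω ((mk f (integrable_of_hasCompactSupport hf hfc) : BeurlingAlgebra ω μ) *
        mk g (integrable_of_hasCompactSupport hg hgc)) =
        ∫ t, ∫ s, f t * (g s * φ (t + s)) ∂μ ∂μ := by
    intro f g hf hfc hg hgc φ hφ hφω
    rw [pairing_apply, integral_mul_eq _ _ φ hφ 1 hφω]
    refine integral_congr_ae ?_
    filter_upwards [coeFn_mk (μ := μ) (ω := ω) f (integrable_of_hasCompactSupport hf hfc)] with t ht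
    rw [ht, integral_const_mul]
    congr 1
    refine integral_congr_ae ?_
    filter_upwards [coeFn_mk (μ := μ) (ω := ω) g (integrable_of_hasCompactSupport hg hgc)] with s hs
    rw [hs]
  rw [← sub_eq_zero]
  refine eq_zero_of_forall_integral_mul_eq_zero _ fun φ hφ hφω => ?_
  have hφω' : ∀ t, ‖φ t‖ ≤ 1 * ω t := fun t => by simpa using hφω t
  rw [← pairing_apply φ hφ 1 hφω', map_sub, key hf hfc hg hgc, key hg hgc hf hfc, sub_eq_zero,
    integral_integral_swap_of_hasCompactSupport]
  · refine integral_congr_ae (Eventually.of_forall fun s => ?_)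
    refine integral_congr_ae (Eventually.of_forall fun t => ?_)
    simp only [add_comm t s]
    ring
  · exact (hf.comp continuous_fst).mul ((hg.comp continuous_snd).mul
      (hφ.comp (continuous_fst.add continuous_snd)))
  · refine HasCompactSupport.intro (hfc.prod hgc) fun x hx => ?_
    simp only [Set.mem_prod, not_and_or] at hx
    rcases hx with hx | hx <;> simp [Function.uncurry, image_eq_zero_of_notMem_tsupport hx]

/-- Convolution is commutative. On continuous functions with compact support this is Fubini's
theorem, which holds for them although `μ` need not be σ-finite; they are dense. -/
protected theorem mul_comm (f g : BeurlingAlgebra ω μ) : f * g = g * f := by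
  have dense : ∀ f : BeurlingAlgebra ω μ, f ∈ closure {h : BeurlingAlgebra ω μ |
      ∃ (k : G → ℂ) (hk : Continuous k) (hc : HasCompactSupport k),
        h = mk k (integrable_of_hasCompactSupport hk hc)} := fun f =>
    Metric.mem_closure_iff.2 fun ε hε => by
      obtain ⟨k, hk, hc, hlt⟩ := exists_hasCompactSupport_norm_sub_lt f hε
      exact ⟨_, ⟨k, hk, hc, rfl⟩, by rwa [dist_eq_norm]⟩
  refine closure_minimal (t := {f : BeurlingAlgebra ω μ | f * g = g * f}) ?_
    (isClosed_eq (by fun_prop) (by fun_prop)) (dense f)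
  rintro _ ⟨k, hk, hc, rfl⟩
  refine closure_minimal (t := {g : BeurlingAlgebra ω μ | _ * g = g * _}) ?_
    (isClosed_eq (by fun_prop) (by fun_prop)) (dense g)
  rintro _ ⟨l, hl, hlc, rfl⟩
  exact mul_comm_of_hasCompactSupport hk hc hl hlc

theorem mul_translate (t : G) (f g : BeurlingAlgebra ω μ) :
    f * translate t g = translate t (f * g) := by
  rw [BeurlingAlgebra.mul_comm, translate_mul, BeurlingAlgebra.mul_comm]

end group

end BeurlingAlgebra

namespace GroupWeight

variable {G : Type*} [AddCommGroup G] [TopologicalSpace G]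

/-! ### The translates of the weight -/

/-- If an associated weight is bounded, then the ratios `ω (t + s) / ω t` are bounded off a compact
set that depends on `s`, with a bound that does not. -/
theorem IsAssociated.exists_ratio_le {ω σ : GroupWeight G} (hσ : ω.IsAssociated σ)
    (hσb : BddAbove (Set.range fun t => σ t)) :
    ∃ C : ℝ, 0 < C ∧ ∀ s, ∃ K : Set G, IsCompact K ∧ ∀ t ∉ K, ω (t + s) ≤ C * ω t := by
  by_cases hG : NoncompactSpace G
  · obtain ⟨M, N, hM, -, h⟩ := hσ hG
    obtain ⟨B, hB⟩ := hσb
    have hB' : ∀ t, σ t ≤ B := fun t => hB ⟨t, rfl⟩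
    have hB0 : 0 < B := (σ.pos 0).trans_le (hB' 0)
    refine ⟨B / M + 1, by positivity, fun s => ?_⟩
    have hlt : limsup (fun t => ω (t + s) / ω t) (cocompact G) < B / M + 1 := by
      refine lt_of_le_of_lt ?_ (lt_add_one _)
      rw [le_div_iff₀ hM, mul_comm]
      exact (h s).1.trans (hB' s)
    obtain ⟨K, hK, hKs⟩ := mem_cocompact.1
      (eventually_lt_of_limsup_lt hlt (ω.isBoundedUnder_ratio s _))
    exact ⟨K, hK, fun t ht => (div_le_iff₀ (ω.pos t)).1 (le_of_lt (hKs ht))⟩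
  · have : CompactSpace G := ⟨by_contra fun h => hG ⟨h⟩⟩
    exact ⟨1, one_pos, fun s => ⟨Set.univ, isCompact_univ, fun t ht => (ht trivial).elim⟩⟩

/-- The bound of `IsAssociated.exists_ratio_le` along an ultrafilter. On a compact group, where
nothing tends to infinity, the weight itself is bounded and any ultrafilter will do. -/
theorem IsAssociated.exists_ultrafilter {ω σ : GroupWeight G} (hσ : ω.IsAssociated σ)
    (hσb : BddAbove (Set.range fun t => σ t)) :
    ∃ (U : Ultrafilter G) (C : ℝ), 0 < C ∧ ∀ s, ∀ᶠ t in U, ω (t + s) ≤ C * ω t := by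
  by_cases hG : NoncompactSpace G
  · obtain ⟨C, hC, h⟩ := hσ.exists_ratio_le hσb
    refine ⟨Ultrafilter.of (cocompact G), C, hC, fun s => ?_⟩
    obtain ⟨K, hK, hKs⟩ := h s
    exact Ultrafilter.of_le (cocompact G) (mem_cocompact.2 ⟨K, hK, hKs⟩)
  · have : CompactSpace G := ⟨by_contra fun h => hG ⟨h⟩⟩
    obtain ⟨C, hC⟩ := (isCompact_range ω.cont).bddAbove
    have hC' : ∀ s, ω s ≤ C := fun s => hC ⟨s, rfl⟩
    refine ⟨pure 0, C, (ω.pos 0).trans_le (hC' 0), fun s => ?_⟩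
    simpa [ω.zero] using hC' s

end GroupWeight

namespace BeurlingAlgebra

variable {G : Type*} [AddCommGroup G] [TopologicalSpace G] [MeasurableSpace G] [BorelSpace G]
  {ω : GroupWeight G} {μ : Measure G}

/-! ### Point derivations and additive functions -/

theorem integrable_mul_of_le {φ : G → ℂ} (hφ : Continuous φ) {C : ℝ}
    (hC : ∀ t, ‖φ t‖ ≤ C * ω t) (f : BeurlingAlgebra ω μ) : Integrable (fun t => f t * φ t) μ := by
  refine (f.integrable_norm.const_mul C).mono'
    ((f.integrable.aestronglyMeasurable.mono_ac (ω.ac_measure μ)).mul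
      hφ.measurable.aestronglyMeasurable) (Eventually.of_forall fun t => ?_)
  rw [norm_mul, mul_comm, ← mul_assoc]
  exact mul_le_mul_of_nonneg_right (hC t) (norm_nonneg _)

theorem integrable_of_one_le (hω : ∀ t, 1 ≤ ω t) (f : BeurlingAlgebra ω μ) :
    Integrable (fun t => f t) μ := by
  simpa using integrable_mul_of_le (ω := ω) (φ := fun _ => 1) continuous_const (C := 1)
    (fun t => by simpa using hω t) f

variable [IsTopologicalAddGroup G] [LocallyCompactSpace G] [μ.IsAddHaarMeasure]

theorem integral_translate_mul (φ : G → ℂ) (t : G) (f : BeurlingAlgebra ω μ) :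
    ∫ s, translate t f s * φ s ∂μ = ∫ s, f s * φ (t + s) ∂μ := by
  rw [← integral_sub_right_eq_self (fun s => f s * φ (t + s)) t]
  refine integral_congr_ae ?_
  filter_upwards [coeFn_translate t f] with s hs
  rw [hs, add_sub_cancel]

theorem augmentation_translate (t : G) (f : BeurlingAlgebra ω μ) :
    augmentation (translate t f) = augmentation f := by
  simpa [augmentation] using integral_translate_mul (fun _ => 1) t f

variable [T2Space G] [μ.Regular]

theorem exists_augmentation_eq_one : ∃ e : BeurlingAlgebra ω μ, augmentation e = 1 := by
  obtain ⟨g, hg, hgc, -, -, hg1⟩ := exists_bump (μ := μ) (univ_mem (f := 𝓝 (0 : G)))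
  have hgi := integrable_of_hasCompactSupport (ω := ω) (μ := μ)
    (Complex.continuous_ofReal.comp hg) (hgc.comp_left (g := ((↑) : ℝ → ℂ)) (by simp))
  refine ⟨mk _ hgi, ?_⟩
  rw [augmentation, integral_congr_ae (coeFn_mk _ hgi)]
  simp only [Function.comp_def]
  rw [integral_complex_ofReal, hg1, Complex.ofReal_one]

theorem integral_mul_add (hω : ∀ t, 1 ≤ ω t) {p : G → ℂ} (hp : Continuous p) {C : ℝ}
    (hC : ∀ t, ‖p t‖ ≤ C * ω t) (z : ℂ) (f : BeurlingAlgebra ω μ) :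
    ∫ t, f t * (z + p t) ∂μ = z * augmentation f + ∫ t, f t * p t ∂μ := by
  rw [augmentation, ← integral_const_mul, ← integral_add
    ((integrable_of_one_le hω f).const_mul z) (integrable_mul_of_le hp hC f)]
  refine integral_congr_ae (Eventually.of_forall fun t => ?_)
  ring

/-- An additive function dominated by the weight gives a point derivation at the augmentation
character. -/
theorem isPointDerivation_pairing (hω : ∀ t, 1 ≤ ω t) {p : G → ℂ} (hp : Continuous p)
    (hadd : ∀ s t, p (s + t) = p s + p t) {C : ℝ} (hC : ∀ t, ‖p t‖ ≤ C * ω t) :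
    IsPointDerivation augmentation (pairing p hp C hC : BeurlingAlgebra ω μ →L[ℂ] ℂ) := by
  intro f g
  rw [pairing_apply, integral_mul_eq f g p hp C hC]
  simp only [hadd, integral_mul_add hω hp hC, ← pairing_apply p hp C hC]
  have e : ∀ t, f t * (p t * augmentation g + pairing p hp C hC g) =
      augmentation g * (f t * p t) + f t * pairing p hp C hC g := fun t => by ring
  simp only [e]
  rw [integral_add ((integrable_mul_of_le hp hC f).const_mul _)
    ((integrable_of_one_le hω f).mul_const _), integral_const_mul, integral_mul_const,
    ← pairing_apply p hp C hC, augmentation, augmentation]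
  ring

/-- If there are no point derivations at the augmentation character, then additive functions
dominated by the weight vanish. -/
theorem eq_zero_of_additive (hω : ∀ t, 1 ≤ ω t)
    (H : ∀ d : BeurlingAlgebra ω μ →L[ℂ] ℂ, IsPointDerivation augmentation d → d = 0)
    {p : G → ℂ} (hp : Continuous p) (hadd : ∀ s t, p (s + t) = p s + p t) {C : ℝ}
    (hC : ∀ t, ‖p t‖ ≤ C * ω t) (t : G) : p t = 0 := by
  have h0 := H _ (isPointDerivation_pairing (μ := μ) hω hp hadd hC)
  obtain ⟨e, he⟩ := exists_augmentation_eq_one (ω := ω) (μ := μ)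
  have h1 : pairing p hp C hC (translate t e) = p t * augmentation e + pairing p hp C hC e := by
    rw [pairing_apply, integral_translate_mul]
    simp only [hadd]
    rw [integral_mul_add hω hp hC, pairing_apply]
  simpa [h0, he] using h1.symm

/-- Every continuous point derivation at the augmentation character is the integral against an
additive function dominated by the weight. -/
theorem exists_additive_of_isPointDerivation (hω : ∀ t, 1 ≤ ω t)
    {d : BeurlingAlgebra ω μ →L[ℂ] ℂ} (hd : IsPointDerivation augmentation d) :
    ∃ (p : G → ℂ) (C : ℝ), Continuous p ∧ (∀ s t, p (s + t) = p s + p t) ∧ 0 ≤ C ∧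
      (∀ t, ‖p t‖ ≤ C * ω t) ∧ ∀ f, d f = ∫ t, f t * p t ∂μ := by
  obtain ⟨a, ha⟩ := exists_augmentation_eq_one (ω := ω) (μ := μ)
  -- `p s` stands for the value of `d` at the point mass at `s`
  let p : G → ℂ := fun s => d (translate s a) - d a
  have hcont : Continuous p := (d.continuous.comp (continuous_translate a)).sub continuous_const
  have key : ∀ s b, d (translate s b) = d b + p s * augmentation b := fun s b => by
    have h : d (a * translate s b) = d (translate s a * b) := by
      rw [mul_translate, translate_mul]
    rw [hd, hd, augmentation_translate, augmentation_translate, ha] at h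
    simp only [p]
    linear_combination h
  have hC : ∀ t, ‖p t‖ ≤ (2 * ‖d‖ * ‖a‖) * ω t := fun t => by
    have h1 : ‖d (translate t a)‖ ≤ ‖d‖ * (ω t * ‖a‖) :=
      d.le_of_opNorm_le_of_le le_rfl (norm_translate_le t a)
    have h2 : ‖d a‖ ≤ ‖d‖ * (ω t * ‖a‖) := d.le_of_opNorm_le_of_le le_rfl
      (le_mul_of_one_le_left (norm_nonneg _) (hω t))
    refine (norm_sub_le _ _).trans ?_
    linarith
  refine ⟨p, _, hcont, fun s t => ?_, by positivity, hC, fun f => ?_⟩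
  · have := key s (translate t a)
    rw [translate_translate, augmentation_translate, ha] at this
    simp only [p] at this ⊢
    linear_combination this
  · have h1 : d (f * a) = d a * augmentation f + ∫ t, f t * p t ∂μ := by
      rw [map_mul_eq, ← integral_mul_add hω hcont hC]
      refine integral_congr_ae (Eventually.of_forall fun t => ?_)
      simp only [smul_eq_mul, key t a, ha, mul_one]
    rw [hd, ha] at h1
    linear_combination h1

/-! ### The bimodule structure of the second dual -/

/-- For fixed `F` in the dual, `f ↦ F · f` as a bounded operator. -/
noncomputable def dualRightL (F : StrongDual ℂ (BeurlingAlgebra ω μ)) :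
    BeurlingAlgebra ω μ →L[ℂ] StrongDual ℂ (BeurlingAlgebra ω μ) :=
  (ContinuousLinearMap.compL ℂ (BeurlingAlgebra ω μ) (BeurlingAlgebra ω μ) ℂ F).comp
    (ContinuousLinearMap.mul ℂ (BeurlingAlgebra ω μ))

theorem dualRight_apply (F : StrongDual ℂ (BeurlingAlgebra ω μ)) (f g : BeurlingAlgebra ω μ) :
    dualRight f F g = F (f * g) := rfl

theorem dualLeft_eq_dualRight (f : BeurlingAlgebra ω μ) :
    dualLeft f = dualRight f := by
  ext F g
  change F (g * f) = F (f * g)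
  rw [BeurlingAlgebra.mul_comm]

theorem dualRight_dualRight (F : StrongDual ℂ (BeurlingAlgebra ω μ)) (f g : BeurlingAlgebra ω μ) :
    dualRight f (dualRight g F) = dualRight (g * f) F := by
  ext h
  change F (g * (f * h)) = F (g * f * h)
  rw [mul_assoc]

theorem bidualLeft_apply (Φ : StrongDual ℂ (StrongDual ℂ (BeurlingAlgebra ω μ)))
    (f : BeurlingAlgebra ω μ) (F : StrongDual ℂ (BeurlingAlgebra ω μ)) :
    bidualLeft f Φ F = Φ (dualRight f F) := rfl

theorem bidualRight_eq_bidualLeft (f : BeurlingAlgebra ω μ) :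
    bidualRight f = bidualLeft f := by
  rw [bidualRight, bidualLeft, dualLeft_eq_dualRight]

end BeurlingAlgebra

/-! ### A functional on the dual with bounded orbit -/

/-- A bounded family in a normed space has a limit along every ultrafilter in the weak-star
topology of the second dual. -/
theorem exists_bidual_tendsto {ι E : Type*} [NormedAddCommGroup E] [NormedSpace ℂ E]
    (U : Ultrafilter ι) {x : ι → E} {R : ℝ} (hx : ∀ i, ‖x i‖ ≤ R) :
    ∃ Θ : StrongDual ℂ (StrongDual ℂ E),
      ∀ F : StrongDual ℂ E, Tendsto (fun i => F (x i)) U (𝓝 (Θ F)) := by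
  have bd : ∀ (F : StrongDual ℂ E) i, ‖F (x i)‖ ≤ R * ‖F‖ := fun F i => by
    rw [mul_comm]
    exact F.le_of_opNorm_le_of_le le_rfl (hx i)
  have lim : ∀ F : StrongDual ℂ E, ∃ z, Tendsto (fun i => F (x i)) U (𝓝 z) := fun F => by
    obtain ⟨z, -, hz⟩ := (isCompact_closedBall (0 : ℂ) (R * ‖F‖)).ultrafilter_le_nhds
      (U.map fun i => F (x i)) (le_principal_iff.2 (mem_map.2 (Eventually.of_forall fun i =>
        mem_closedBall_zero_iff.2 (bd F i))))
    exact ⟨z, hz⟩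
  choose Θ hΘ using lim
  refine ⟨LinearMap.mkContinuous
    { toFun := Θ
      map_add' := fun F F' => tendsto_nhds_unique (hΘ (F + F')) ((hΘ F).add (hΘ F'))
      map_smul' := fun c F => tendsto_nhds_unique (hΘ (c • F)) ((hΘ F).const_mul c) }
    R fun F => ?_, hΘ⟩
  exact le_of_tendsto (hΘ F).norm (Eventually.of_forall (bd F))

namespace BeurlingAlgebra

variable {G : Type*} [AddCommGroup G] [TopologicalSpace G] [MeasurableSpace G] [BorelSpace G]
  {ω : GroupWeight G} {μ : Measure G} [IsTopologicalAddGroup G] [LocallyCompactSpace G]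
  [μ.IsAddHaarMeasure] [T2Space G] [μ.Regular]

/-- The translates of a suitable element, paired with the weight, are comparable to the weight. -/
theorem exists_le_norm_pairing_weight (hF : ∀ t, ‖(ω t : ℂ)‖ ≤ 1 * ω t) :
    ∃ (e : BeurlingAlgebra ω μ) (c : ℝ), 0 < c ∧ ∀ t, c * ω t ≤
      ‖pairing (fun t => (ω t : ℂ)) (Complex.continuous_ofReal.comp ω.cont) 1 hF
        (translate t e)‖ := by
  obtain ⟨g, hg, hgc, hg0, -, hg1⟩ := exists_bump (μ := μ) (univ_mem (f := 𝓝 (0 : G)))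
  have hgi := integrable_of_hasCompactSupport (ω := ω) (μ := μ)
    (Complex.continuous_ofReal.comp hg) (hgc.comp_left (g := ((↑) : ℝ → ℂ)) (by simp))
  have hinv : Continuous fun s => (ω (-s))⁻¹ :=
    (ω.cont.comp continuous_neg).inv₀ fun s => (ω.pos _).ne'
  have hne : ∃ s, g s ≠ 0 := by
    by_contra! h
    simp [h] at hg1
  obtain ⟨s₀, hs₀⟩ := hne
  have hpos : 0 < ∫ s, g s * (ω (-s))⁻¹ ∂μ :=
    (hg.mul hinv).integral_pos_of_hasCompactSupport_nonneg_nonzero hgc.mul_right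
      (fun s => mul_nonneg (hg0 s) (inv_nonneg.2 (ω.pos _).le)) (x := s₀)
      (mul_ne_zero hs₀ (inv_ne_zero (ω.pos _).ne'))
  refine ⟨mk _ hgi, _, hpos, fun t => ?_⟩
  have e1 : pairing (fun t => (ω t : ℂ)) (Complex.continuous_ofReal.comp ω.cont) 1 hF
      (translate t (mk _ hgi : BeurlingAlgebra ω μ)) = ((∫ s, g s * ω (t + s) ∂μ : ℝ) : ℂ) := by
    rw [pairing_apply, integral_translate_mul, ← integral_complex_ofReal]
    refine integral_congr_ae ?_
    filter_upwards [coeFn_mk _ hgi] with s hs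
    rw [hs]
    simp
  rw [e1, Complex.norm_real, ← integral_mul_const]
  refine le_trans ?_ (le_abs_self _)
  have hω : Continuous fun s => ω (t + s) := ω.cont.comp (by fun_prop)
  refine integral_mono
    (((hg.mul hinv).integrable_of_hasCompactSupport hgc.mul_right).mul_const _)
    ((hg.mul hω).integrable_of_hasCompactSupport hgc.mul_right) fun s => ?_
  rw [mul_assoc]
  refine mul_le_mul_of_nonneg_left ?_ (hg0 s)
  rw [inv_mul_le_iff₀ (ω.pos _), mul_comm]
  simpa using ω.add_le (t + s) (-s)

/-- There is an element of the second dual whose orbit under translation is bounded, and which is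
far enough from zero that none of its translates vanishes on the orbit of a fixed element of the
algebra. It is a limit of normalized translates `ω(t)⁻¹ δ_t * f` as `t` goes to infinity. -/
theorem exists_bidual_bounded_orbit {σ : GroupWeight G} (hσ : ω.IsAssociated σ)
    (hσb : BddAbove (Set.range fun t => σ t)) :
    ∃ (Θ : StrongDual ℂ (StrongDual ℂ (BeurlingAlgebra ω μ))) (C : ℝ), 0 ≤ C ∧
      (∀ F s f, ‖Θ (dualRight (translate s f) F)‖ ≤ C * ‖F‖ * ‖f‖) ∧
      ∃ e F, ∀ s, Θ (dualRight (translate s e) F) ≠ 0 := by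
  obtain ⟨U, C, hC, hU⟩ := hσ.exists_ultrafilter hσb
  have hF : ∀ t, ‖(ω t : ℂ)‖ ≤ 1 * ω t := fun t => by
    rw [Complex.norm_real, Real.norm_of_nonneg (ω.pos t).le, one_mul]
  obtain ⟨f₁, c, hc, hle⟩ := exists_le_norm_pairing_weight (μ := μ) hF
  set W : BeurlingAlgebra ω μ →L[ℂ] ℂ :=
    pairing (fun t => (ω t : ℂ)) (Complex.continuous_ofReal.comp ω.cont) 1 hF with hW
  have hx : ∀ t, ‖((ω t)⁻¹ : ℂ) • translate t f₁‖ ≤ ‖f₁‖ := fun t => by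
    rw [norm_smul, norm_inv, Complex.norm_real, Real.norm_of_nonneg (ω.pos t).le,
      inv_mul_le_iff₀ (ω.pos t)]
    exact norm_translate_le t f₁
  obtain ⟨Θ, hΘ⟩ := exists_bidual_tendsto U hx
  have hval : ∀ (F : StrongDual ℂ (BeurlingAlgebra ω μ)) (s : G) (f : BeurlingAlgebra ω μ) (t : G),
      dualRight (translate s f) F (((ω t)⁻¹ : ℂ) • translate t f₁) =
        ((ω t)⁻¹ : ℂ) * F (f * translate (t + s) f₁) := fun F s f t => by
    rw [map_smul, smul_eq_mul, dualRight_apply, translate_mul, ← mul_translate,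
      translate_translate, add_comm s t]
  refine ⟨Θ, C * ‖f₁‖, by positivity, fun F s f => ?_, ?_⟩
  · refine le_of_tendsto (hΘ _).norm ?_
    filter_upwards [hU s] with t ht
    rw [hval, norm_mul, norm_inv, Complex.norm_real, Real.norm_of_nonneg (ω.pos t).le,
      inv_mul_le_iff₀ (ω.pos t)]
    have h1 : ‖f * translate (t + s) f₁‖ ≤ ‖f‖ * (C * ω t * ‖f₁‖) :=
      (norm_mul_le _ _).trans (mul_le_mul_of_nonneg_left ((norm_translate_le _ _).trans
        (mul_le_mul_of_nonneg_right ht (norm_nonneg _))) (norm_nonneg _))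
    refine (F.le_of_opNorm_le_of_le le_rfl h1).trans (le_of_eq ?_)
    ring
  · obtain ⟨e, he⟩ := exists_norm_mul_sub_lt f₁ (half_pos hc)
    have hlow : ∀ u, c / 2 * ω u ≤ ‖W (e * translate u f₁)‖ := fun u => by
      have h1 : ‖W (e * translate u f₁ - translate u f₁)‖ ≤ 1 * (ω u * (c / 2)) := by
        refine W.le_of_opNorm_le_of_le (norm_pairing_le _ _ _ _ zero_le_one) ?_
        have : e * translate u f₁ - translate u f₁ = translate u (e * f₁ - f₁) := by
          rw [mul_translate, ← translateL_apply, ← translateL_apply, ← translateL_apply, map_sub]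
        rw [this]
        exact (norm_translate_le _ _).trans (mul_le_mul_of_nonneg_left he.le (ω.pos u).le)
      have h2 := norm_sub_norm_le (W (translate u f₁)) (W (e * translate u f₁))
      rw [norm_sub_rev, ← map_sub] at h2
      have h3 := hle u
      linarith
    refine ⟨e, W, fun s h0 => ?_⟩
    have hlim := (hΘ (dualRight (translate s e) W)).norm
    have : c / 2 / ω (-s) ≤ ‖Θ (dualRight (translate s e) W)‖ := by
      refine ge_of_tendsto' hlim fun t => ?_
      rw [hval, norm_mul, norm_inv, Complex.norm_real, Real.norm_of_nonneg (ω.pos t).le,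
        le_inv_mul_iff₀ (ω.pos t)]
      refine le_trans ?_ (hlow (t + s))
      have h4 : ω t ≤ ω (t + s) * ω (-s) := by simpa using ω.add_le (t + s) (-s)
      rw [mul_div_assoc', div_le_iff₀ (ω.pos _)]
      nlinarith
    rw [h0, norm_zero] at this
    exact absurd this (not_le.2 (div_pos (half_pos hc) (ω.pos _)))

/-! ### From a point derivation to a derivation into the second dual -/

theorem eq_zero_of_forall_pairing {φ : G → ℂ} (hφ : Continuous φ) {C : ℝ}
    (hC : ∀ t, ‖φ t‖ ≤ C * ω t) (h : ∀ f : BeurlingAlgebra ω μ, pairing φ hφ C hC f = 0) (t : G) :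
    φ t = 0 := by
  by_contra ht
  obtain ⟨g, hgc, hg0, hgt⟩ := exists_continuous_nonneg_pos t
  have hk : Continuous fun s => (g s : ℂ) * (starRingEnd ℂ) (φ s) :=
    (Complex.continuous_ofReal.comp g.continuous).mul (Complex.continuous_conj.comp hφ)
  have hkc : HasCompactSupport fun s => (g s : ℂ) * (starRingEnd ℂ) (φ s) :=
    (hgc.comp_left (g := ((↑) : ℝ → ℂ)) (by simp)).mul_right
  have h0 := h (mk _ (integrable_of_hasCompactSupport hk hkc))
  have hpos : 0 < ∫ s, g s * ‖φ s‖ ^ 2 ∂μ :=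
    (g.continuous.mul (hφ.norm.pow 2)).integral_pos_of_hasCompactSupport_nonneg_nonzero
      hgc.mul_right (fun s => mul_nonneg (hg0 s) (sq_nonneg _)) (x := t)
      (mul_ne_zero hgt (pow_ne_zero 2 (norm_ne_zero_iff.2 ht)))
  have e : pairing φ hφ C hC (mk _ (integrable_of_hasCompactSupport hk hkc) :
      BeurlingAlgebra ω μ) = ((∫ s, g s * ‖φ s‖ ^ 2 ∂μ : ℝ) : ℂ) := by
    rw [pairing_apply, ← integral_complex_ofReal]
    refine integral_congr_ae ?_
    filter_upwards [coeFn_mk _ (integrable_of_hasCompactSupport (ω := ω) (μ := μ) hk hkc)] with s hs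
    rw [hs, mul_assoc, mul_comm ((starRingEnd ℂ) _), Complex.mul_conj, Complex.normSq_eq_norm_sq]
    push_cast
    rfl
  rw [e, Complex.ofReal_eq_zero] at h0
  exact hpos.ne' h0

section derivation

variable {p : G → ℂ} {C B : ℝ} {Θ : StrongDual ℂ (StrongDual ℂ (BeurlingAlgebra ω μ))}

theorem continuous_mul_bidual (hp : Continuous p) (e : BeurlingAlgebra ω μ)
    (F : StrongDual ℂ (BeurlingAlgebra ω μ)) :
    Continuous fun s => p s * Θ (dualRight (translate s e) F) :=
  hp.mul (Θ.continuous.comp ((dualRightL F).continuous.comp (continuous_translate e)))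

theorem norm_mul_bidual_le (hpB : ∀ t, ‖p t‖ ≤ B * ω t) (hB : 0 ≤ B)
    (hΘ : ∀ F s f, ‖Θ (dualRight (translate s f) F)‖ ≤ C * ‖F‖ * ‖f‖) (e : BeurlingAlgebra ω μ)
    (F : StrongDual ℂ (BeurlingAlgebra ω μ)) (s : G) :
    ‖p s * Θ (dualRight (translate s e) F)‖ ≤ (B * C * ‖e‖ * ‖F‖) * ω s := by
  rw [norm_mul]
  refine (mul_le_mul (hpB s) (hΘ F s e) (norm_nonneg _)
    (mul_nonneg hB (ω.pos s).le)).trans (le_of_eq ?_)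
  ring

/-- The operator `f ↦ ∫ f s p s (δ_s * e · Θ) ds` from the algebra to its second dual. -/
noncomputable def additiveOperator (hp : Continuous p) (hpB : ∀ t, ‖p t‖ ≤ B * ω t) (hB : 0 ≤ B)
    (hΘ : ∀ F s f, ‖Θ (dualRight (translate s f) F)‖ ≤ C * ‖F‖ * ‖f‖) (hC : 0 ≤ C)
    (e : BeurlingAlgebra ω μ) :
    BeurlingAlgebra ω μ →L[ℂ] StrongDual ℂ (StrongDual ℂ (BeurlingAlgebra ω μ)) :=
  ContinuousLinearMap.flip <| LinearMap.mkContinuous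
    { toFun := fun F => pairing (fun s => p s * Θ (dualRight (translate s e) F))
        (continuous_mul_bidual hp e F) _ (norm_mul_bidual_le hpB hB hΘ e F)
      map_add' := fun F F' => by
        ext f
        rw [add_apply, pairing_apply, pairing_apply, pairing_apply,
          ← integral_add
            (integrable_mul_of_le (continuous_mul_bidual hp e F) (norm_mul_bidual_le hpB hB hΘ e F) f)
            (integrable_mul_of_le (continuous_mul_bidual hp e F')
              (norm_mul_bidual_le hpB hB hΘ e F') f)]
        refine integral_congr_ae (Eventually.of_forall fun s => ?_)
        simp only [map_add]
        ring
      map_smul' := fun c F => by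
        ext f
        rw [RingHom.id_apply, smul_apply, pairing_apply, pairing_apply,
          smul_eq_mul, ← integral_const_mul]
        refine integral_congr_ae (Eventually.of_forall fun s => ?_)
        simp only [map_smul, smul_eq_mul]
        ring }
    (B * C * ‖e‖) fun F => norm_pairing_le _ (continuous_mul_bidual hp e F) _
      (norm_mul_bidual_le hpB hB hΘ e F) (by positivity)

variable (hp : Continuous p) (hpB : ∀ t, ‖p t‖ ≤ B * ω t) (hB : 0 ≤ B)
  (hΘ : ∀ F s f, ‖Θ (dualRight (translate s f) F)‖ ≤ C * ‖F‖ * ‖f‖) (hC : 0 ≤ C)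
  (e : BeurlingAlgebra ω μ)

theorem additiveOperator_apply (f : BeurlingAlgebra ω μ)
    (F : StrongDual ℂ (BeurlingAlgebra ω μ)) :
    additiveOperator hp hpB hB hΘ hC e f F =
      ∫ s, f s * (p s * Θ (dualRight (translate s e) F)) ∂μ := rfl

/-- For additive `p` the operator `additiveOperator` is a derivation. The exchange of integrals that
this takes is the continuity of the functional `x ↦ ∫ g s p s Θ (F · (δ_s * x)) ds`, evaluated at
`x = f * e`; the measure need not be σ-finite. -/
theorem additiveOperator_mul (hadd : ∀ s t, p (s + t) = p s + p t) (f g : BeurlingAlgebra ω μ) :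
    additiveOperator hp hpB hB hΘ hC e (f * g) =
      bidualLeft f (additiveOperator hp hpB hB hΘ hC e g) +
        bidualRight g (additiveOperator hp hpB hB hΘ hC e f) := by
  ext F
  rw [bidualRight_eq_bidualLeft, add_apply, bidualLeft_apply, bidualLeft_apply]
  set L : BeurlingAlgebra ω μ →L[ℂ] ℂ := Θ.comp (dualRightL F) with hL
  have hLa : ∀ x, Θ (dualRight x F) = L x := fun x => rfl
  have hLb : ∀ h x, Θ (dualRight x (dualRight h F)) = L (h * x) := fun h x => by
    rw [dualRight_dualRight]
    rfl
  simp only [additiveOperator_apply, hLb, hLa]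
  have hcx : ∀ x, Continuous fun s => p s * L (translate s x) := fun x =>
    continuous_mul_bidual (Θ := Θ) hp x F
  have hbx : ∀ x s, ‖p s * L (translate s x)‖ ≤ (B * C * ‖x‖ * ‖F‖) * ω s := fun x s =>
    norm_mul_bidual_le hpB hB hΘ x F s
  let L' : BeurlingAlgebra ω μ →L[ℂ] ℂ := LinearMap.mkContinuous
    { toFun := fun x => ∫ s, g s * (p s * L (translate s x)) ∂μ
      map_add' := fun x y => by
        rw [← integral_add (integrable_mul_of_le (hcx x) (hbx x) g)
          (integrable_mul_of_le (hcx y) (hbx y) g)]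
        refine integral_congr_ae (Eventually.of_forall fun s => ?_)
        simp only [translate_add, map_add]
        ring
      map_smul' := fun c x => by
        rw [RingHom.id_apply, smul_eq_mul, ← integral_const_mul]
        refine integral_congr_ae (Eventually.of_forall fun s => ?_)
        simp only [translate_smul, map_smul, smul_eq_mul]
        ring }
    (B * C * ‖F‖ * ‖g‖) fun x => by
      have h1 := (pairing (μ := μ) _ (hcx x) _ (hbx x)).le_of_opNorm_le
        (norm_pairing_le _ _ _ _ (by positivity)) g
      refine le_trans h1 (le_of_eq ?_)
      ring
  have hL' : ∀ x, L' x = ∫ s, g s * (p s * L (translate s x)) ∂μ := fun x => rfl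
  -- the inner integral of `∫∫ f t g s p (t + s) L (δ_{t+s} * e) ds dt`
  have inner : ∀ t, ∫ s, g s * (p (t + s) * L (translate (t + s) e)) ∂μ =
      p t * L (g * translate t e) + L' (translate t e) := fun t => by
    have hc : Continuous fun s => L (translate s (translate t e)) :=
      L.continuous.comp (continuous_translate _)
    have hb : ∀ s, ‖L (translate s (translate t e))‖ ≤ (‖L‖ * ‖translate t e‖) * ω s := fun s => by
      refine (L.le_of_opNorm_le_of_le le_rfl (norm_translate_le _ _)).trans (le_of_eq ?_)
      ring
    rw [map_mul_eq L g, hL']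
    simp only [smul_eq_mul]
    rw [← integral_const_mul, ← integral_add
      (((integrable_mul_of_le hc hb g)).const_mul (p t))
      (integrable_mul_of_le (hcx _) (hbx _) g)]
    refine integral_congr_ae (Eventually.of_forall fun s => ?_)
    simp only [hadd, translate_translate, add_comm t s]
    ring
  rw [integral_mul_eq f g (fun s => p s * L (translate s e)) (hcx e) _ (hbx e)]
  simp only [inner]
  have hi1 : Integrable (fun t => f t * (p t * L (g * translate t e))) μ := by
    simp only [mul_translate]
    exact integrable_mul_of_le (hcx (g * e)) (hbx (g * e)) f
  have hi2 : Integrable (fun t => f t * L' (translate t e)) μ := by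
    refine integrable_mul_of_le (C := ‖L'‖ * ‖e‖) (L'.continuous.comp (continuous_translate e))
      (fun t => ?_) f
    refine (L'.le_of_opNorm_le_of_le le_rfl (norm_translate_le t e)).trans (le_of_eq ?_)
    ring
  have hsum : ∫ s, g s * (p s * L (f * translate s e)) ∂μ = ∫ t, f t * L' (translate t e) ∂μ := by
    have h1 := map_mul_eq L' f e
    simp only [smul_eq_mul] at h1
    rw [← h1, hL']
    simp only [mul_translate]
  rw [hsum, add_comm, ← integral_add hi1 hi2]
  simp only [mul_add]

end derivation

/-- If the algebra is 2-weakly amenable, then there is no non-zero point derivation at the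
augmentation character. -/
theorem eq_zero_of_isTwoWeaklyAmenable (hω : ∀ t, 1 ≤ ω t) {σ : GroupWeight G}
    (hσ : ω.IsAssociated σ) (hσb : BddAbove (Set.range fun t => σ t))
    (H : IsTwoWeaklyAmenable (BeurlingAlgebra ω μ)) (d : BeurlingAlgebra ω μ →L[ℂ] ℂ)
    (hd : IsPointDerivation augmentation d) : d = 0 := by
  obtain ⟨p, B, hp, hadd, hB, hpB, hdp⟩ := exists_additive_of_isPointDerivation hω hd
  obtain ⟨Θ, C, hC, hΘ, e, F, hne⟩ := exists_bidual_bounded_orbit (μ := μ) hσ hσb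
  obtain ⟨Φ, hΦ⟩ := H (additiveOperator hp hpB hB hΘ hC e)
    (additiveOperator_mul hp hpB hB hΘ hC e hadd)
  have h0 : ∀ t, p t * Θ (dualRight (translate t e) F) = 0 := by
    refine eq_zero_of_forall_pairing (μ := μ) (continuous_mul_bidual hp e F)
      (norm_mul_bidual_le hpB hB hΘ e F) fun f => ?_
    have h1 : additiveOperator hp hpB hB hΘ hC e f = 0 := by
      rw [hΦ, bidualRight_eq_bidualLeft]
      exact sub_self (bidualLeft f Φ)
    exact congrArg (fun Ψ => Ψ F) h1
  have hp0 : ∀ t, p t = 0 := fun t => (mul_eq_zero.1 (h0 t)).resolve_right (hne t)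
  ext f
  simp [hdp, hp0]

end BeurlingAlgebra

theorem exists_norm_apply_apply_le {E F : Type*} [SeminormedAddCommGroup E] [NormedSpace ℂ E]
    [SeminormedAddCommGroup F] [NormedSpace ℂ F] (D : E →L[ℂ] F →L[ℂ] ℂ) :
    ∃ Q : ℝ, 0 ≤ Q ∧ ∀ x y, ‖D x y‖ ≤ Q * ‖x‖ * ‖y‖ :=
  ⟨‖D‖, D.opNorm_nonneg, D.le_opNorm₂⟩

namespace BeurlingAlgebra

variable {G : Type*} [AddCommGroup G] [TopologicalSpace G] [MeasurableSpace G] [BorelSpace G]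
  {ω : GroupWeight G} {μ : Measure G}

/-! ### Restriction to a measurable set -/

theorem norm_mk_indicator_le {K : Set G} (hK : MeasurableSet K) (f : BeurlingAlgebra ω μ) :
    ‖(mk (K.indicator f) (f.integrable.indicator hK) : BeurlingAlgebra ω μ)‖ ≤ 1 * ‖f‖ := by
  rw [one_mul, norm_mk, norm_eq f]
  refine integral_mono_of_nonneg (Eventually.of_forall fun t =>
    mul_nonneg (ω.pos t).le (norm_nonneg _)) f.integrable_norm (Eventually.of_forall fun t => ?_)
  exact mul_le_mul_of_nonneg_left (norm_indicator_le_norm_self _ _) (ω.pos t).le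

/-- Multiplication by the indicator function of a measurable set. -/
noncomputable def restrictL {K : Set G} (hK : MeasurableSet K) :
    BeurlingAlgebra ω μ →L[ℂ] BeurlingAlgebra ω μ :=
  LinearMap.mkContinuous
    { toFun := fun f => mk (K.indicator f) (f.integrable.indicator hK)
      map_add' := fun f g => by
        apply ext_ae
        filter_upwards [coeFn_mk _ ((f + g).integrable.indicator hK),
          coeFn_mk _ (f.integrable.indicator hK), coeFn_mk _ (g.integrable.indicator hK),
          coeFn_add (mk _ (f.integrable.indicator hK)) (mk _ (g.integrable.indicator hK)),
          coeFn_add f g] with t h1 h2 h3 h4 h5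
        rw [h1, h4, h2, h3]
        by_cases ht : t ∈ K <;> simp [ht, h5]
      map_smul' := fun c f => by
        apply ext_ae
        filter_upwards [coeFn_mk _ ((c • f).integrable.indicator hK),
          coeFn_mk _ (f.integrable.indicator hK),
          coeFn_smul c (mk _ (f.integrable.indicator hK)), coeFn_smul c f] with t h1 h2 h3 h4
        rw [h1, RingHom.id_apply, h3, h2]
        by_cases ht : t ∈ K <;> simp [ht, h4] }
    1 (norm_mk_indicator_le hK)

theorem coeFn_restrictL {K : Set G} (hK : MeasurableSet K) (f : BeurlingAlgebra ω μ) :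
    ⇑(restrictL hK f) =ᵐ[μ] K.indicator f :=
  coeFn_mk _ (f.integrable.indicator hK)

theorem norm_restrictL_le {K : Set G} (hK : MeasurableSet K) (f : BeurlingAlgebra ω μ) :
    ‖restrictL hK f‖ ≤ 1 * ‖f‖ := norm_mk_indicator_le hK f

theorem restrictL_add_compl {K : Set G} (hK : MeasurableSet K) (f : BeurlingAlgebra ω μ) :
    restrictL hK f + restrictL hK.compl f = f := by
  apply ext_ae
  filter_upwards [coeFn_restrictL hK f, coeFn_restrictL hK.compl f,
    coeFn_add (restrictL hK f) (restrictL hK.compl f)] with t h1 h2 h3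
  rw [h3, h1, h2]
  by_cases ht : t ∈ K <;> simp [ht]

variable [IsTopologicalAddGroup G] [μ.IsAddHaarMeasure]

theorem translate_zero (f : BeurlingAlgebra ω μ) : translate 0 f = f := by
  apply ext_ae
  filter_upwards [coeFn_translate 0 f] with t ht
  rw [ht, sub_zero]

theorem norm_restrictL_translate_le {K : Set G} (hK : MeasurableSet K) {s : G} {C : ℝ}
    (hC0 : 0 ≤ C) (hC : ∀ t ∈ K, ω t ≤ C * ω (t - s)) (f : BeurlingAlgebra ω μ) :
    ‖restrictL hK (translate s f)‖ ≤ C * ‖f‖ := by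
  rw [norm_eq f, ← integral_const_mul, ← integral_sub_right_eq_self (fun t => C * (ω t * ‖f t‖)) s,
    norm_eq]
  refine integral_mono_ae (integrable_norm _)
    ((f.integrable_norm.const_mul C).comp_sub_right s) ?_
  filter_upwards [coeFn_restrictL hK (translate s f), coeFn_translate s f] with t h1 h2
  rw [h1]
  by_cases ht : t ∈ K
  · rw [Set.indicator_of_mem ht, h2, ← mul_assoc]
    exact mul_le_mul_of_nonneg_right (hC t ht) (norm_nonneg _)
  · rw [Set.indicator_of_notMem ht, norm_zero, mul_zero]
    have := ω.pos (t - s)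
    positivity

theorem norm_restrictL_translate_le_of_isCompact [T2Space G] (hω : ∀ t, 1 ≤ ω t) {K : Set G}
    (hK : IsCompact K) :
    ∃ C : ℝ, ∀ s (f : BeurlingAlgebra ω μ),
      ‖restrictL hK.measurableSet (translate s f)‖ ≤ C * ‖f‖ := by
  obtain ⟨C, hC⟩ := (hK.image ω.cont).bddAbove
  refine ⟨C ⊔ 0, fun s f => norm_restrictL_translate_le _ (le_max_right _ _) (fun t ht => ?_) f⟩
  have h1 : ω t ≤ C := hC ⟨t, ht, rfl⟩
  exact (h1.trans (le_max_left _ _)).trans (le_mul_of_one_le_right (le_max_right _ _) (hω _))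

variable [LocallyCompactSpace G] [T2Space G] [μ.Regular]

/-! ### The translation defect of a derivation -/

section defect

variable (D : BeurlingAlgebra ω μ →L[ℂ] StrongDual ℂ (StrongDual ℂ (BeurlingAlgebra ω μ)))

/-- The value at `F` of `δ_{-s} · D (δ_s * a) - D a`, that is, of `a · (δ_{-s} · D δ_s)` for the
extension of a derivation `D` to point masses. -/
noncomputable def defect (a : BeurlingAlgebra ω μ) (F : StrongDual ℂ (BeurlingAlgebra ω μ))
    (s : G) : ℂ :=
  D (translate s a) (F.comp (translateL (-s))) - D a F

variable {D}

theorem defect_add_right (a : BeurlingAlgebra ω μ) (F F' : StrongDual ℂ (BeurlingAlgebra ω μ))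
    (s : G) : defect D a (F + F') s = defect D a F s + defect D a F' s := by
  simp only [defect, ContinuousLinearMap.add_comp, map_add]
  ring

/-- A bound for the defect at `s` in terms of the norm of the translate of `F` by `-s` only. -/
theorem norm_defect_le (hω : ∀ t, 1 ≤ ω t) {Q : ℝ} (hQ0 : 0 ≤ Q)
    (hQ : ∀ a F, ‖D a F‖ ≤ Q * ‖a‖ * ‖F‖) (a : BeurlingAlgebra ω μ)
    (F : StrongDual ℂ (BeurlingAlgebra ω μ)) {s : G} {R : ℝ} (hR : 0 ≤ R)
    (hF : ∀ f, ‖F (translate (-s) f)‖ ≤ R * ‖f‖) :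
    ‖defect D a F s‖ ≤ (Q * ‖a‖ * (R + ‖F‖)) * ω s := by
  have h1 : ‖F.comp (translateL (-s))‖ ≤ R := ContinuousLinearMap.opNorm_le_bound _ hR hF
  have h2 : ‖D (translate s a) (F.comp (translateL (-s)))‖ ≤ Q * (ω s * ‖a‖) * R := by
    have := ω.pos s
    exact (hQ _ _).trans (mul_le_mul
      (mul_le_mul_of_nonneg_left (norm_translate_le s a) hQ0) h1 (norm_nonneg _) (by positivity))
  have h3 : ‖D a F‖ ≤ Q * ‖a‖ * ‖F‖ * ω s :=
    (hQ a F).trans (le_mul_of_one_le_right (by positivity) (hω s))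
  refine (norm_sub_le _ _).trans ?_
  linarith

variable (hD : ∀ a b F, D (a * b) F = D b (dualRight a F) + D a (dualRight b F))
include hD

theorem defect_mul (b c : BeurlingAlgebra ω μ) (F : StrongDual ℂ (BeurlingAlgebra ω μ)) (s : G) :
    defect D (b * c) F s =
      D (translate s b) (dualRight (translate (-s) c) F) - D b (dualRight c F) := by
  have h1 : dualRight (translate s b) (F.comp (translateL (-s))) = dualRight b F := by
    ext x
    change F (translate (-s) (translate s b * x)) = F (b * x)
    rw [translate_mul, translate_translate, neg_add_cancel, translate_zero]
  have h2 : dualRight c (F.comp (translateL (-s))) = dualRight (translate (-s) c) F := by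
    ext x
    change F (translate (-s) (c * x)) = F (translate (-s) c * x)
    rw [translate_mul]
  rw [defect, ← translate_mul, hD, hD b c, h1, h2]
  ring

theorem defect_mul_add (b c : BeurlingAlgebra ω μ) (F : StrongDual ℂ (BeurlingAlgebra ω μ))
    (s t : G) : defect D (b * c) F (s + t) = defect D (b * c) F s + defect D (b * c) F t := by
  -- the defect depends on the product `b * c` only, so a translation can be moved between factors
  have h : b * c = translate t b * translate (-t) c := by
    rw [mul_translate, translate_mul, translate_translate, neg_add_cancel, translate_zero]
  have h1 : defect D (b * c) F s = defect D (translate t b * translate (-t) c) F s := by rw [← h]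
  rw [h1, defect_mul hD, defect_mul hD, defect_mul hD, translate_translate, translate_translate,
    neg_add]
  ring

theorem continuous_defect_mul (b c : BeurlingAlgebra ω μ)
    (F : StrongDual ℂ (BeurlingAlgebra ω μ)) : Continuous (defect D (b * c) F) := by
  simp only [funext (defect_mul hD b c F)]
  refine Continuous.sub ?_ continuous_const
  exact (D.continuous.comp (continuous_translate b)).clm_apply
    ((dualRightL F).continuous.comp ((continuous_translate c).comp continuous_neg))

variable (hω : ∀ t, 1 ≤ ω t)
  (H : ∀ d : BeurlingAlgebra ω μ →L[ℂ] ℂ, IsPointDerivation augmentation d → d = 0)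
include hω H

theorem defect_mul_eq_zero_of_bounded (b c : BeurlingAlgebra ω μ)
    {F : StrongDual ℂ (BeurlingAlgebra ω μ)} {R : ℝ}
    (hF : ∀ s f, ‖F (translate s f)‖ ≤ R * ‖f‖) (s : G) : defect D (b * c) F s = 0 := by
  obtain ⟨Q, hQ0, hQ⟩ := exists_norm_apply_apply_le D
  refine eq_zero_of_additive (μ := μ) hω H (continuous_defect_mul hD b c F)
    (defect_mul_add hD b c F) (fun t => norm_defect_le (R := R ⊔ 0) hω hQ0 hQ _ _ (le_max_right _ _) fun f =>
      (hF (-t) f).trans ?_) s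
  gcongr
  exact le_max_left _ _

/-- The defect vanishes. The part of `F` on a compact set has bounded translates and contributes
nothing; the translate by `-s` of the part off a large compact set is bounded uniformly in `s`. -/
theorem defect_mul_eq_zero {σ : GroupWeight G} (hσ : ω.IsAssociated σ)
    (hσb : BddAbove (Set.range fun t => σ t)) (b c : BeurlingAlgebra ω μ)
    (F : StrongDual ℂ (BeurlingAlgebra ω μ)) (s : G) : defect D (b * c) F s = 0 := by
  obtain ⟨C, hC, hK⟩ := hσ.exists_ratio_le hσb
  obtain ⟨Q, hQ0, hQ⟩ := exists_norm_apply_apply_le D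
  refine eq_zero_of_additive (μ := μ) hω H (continuous_defect_mul hD b c F)
    (defect_mul_add hD b c F) (C := Q * ‖b * c‖ * (‖F‖ * C + ‖F‖)) (fun t => ?_) s
  -- the ratio `ω x / ω (x + t)` is at most `C` for `x` off the compact set `K`
  obtain ⟨K', hK', hle⟩ := hK (-t)
  obtain ⟨K, hKc, hKle⟩ : ∃ K : Set G, IsCompact K ∧ ∀ x ∉ K, ω x ≤ C * ω (x - -t) := by
    refine ⟨(fun x => x + -t) '' K', hK'.image (by fun_prop), fun x hx => ?_⟩
    have := hle (x + t) fun h => hx ⟨x + t, h, by simp⟩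
    simpa using this
  have hsplit : F = F.comp (restrictL hKc.measurableSet) +
      F.comp (restrictL hKc.measurableSet.compl) := by
    ext f
    change F f = F (restrictL hKc.measurableSet f) + F (restrictL hKc.measurableSet.compl f)
    rw [← map_add, restrictL_add_compl]
  obtain ⟨R, hR⟩ := norm_restrictL_translate_le_of_isCompact (μ := μ) hω hKc
  have h1 : defect D (b * c) (F.comp (restrictL hKc.measurableSet)) t = 0 :=
    defect_mul_eq_zero_of_bounded hD hω H b c (R := ‖F‖ * R) (fun s f =>
      (F.le_of_opNorm_le_of_le le_rfl (hR s f)).trans (mul_assoc _ _ _).ge) t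
  rw [hsplit, defect_add_right, h1, zero_add, ← hsplit]
  have h2 : ‖F.comp (restrictL hKc.measurableSet.compl)‖ ≤ ‖F‖ :=
    ContinuousLinearMap.opNorm_le_bound _ (norm_nonneg _) fun f => by
      refine F.le_of_opNorm_le_of_le le_rfl ?_
      simpa using norm_restrictL_le hKc.measurableSet.compl f
  refine (norm_defect_le (R := ‖F‖ * C) hω hQ0 hQ _ _ (by positivity) fun f =>
    (F.le_of_opNorm_le_of_le le_rfl (norm_restrictL_translate_le _ hC.le hKle f)).trans
      (mul_assoc _ _ _).ge).trans ?_
  have := ω.pos t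
  gcongr

end defect

/-- If there is no non-zero point derivation at the augmentation character, then the algebra is
2-weakly amenable; in fact every bounded derivation into the second dual vanishes. -/
theorem isTwoWeaklyAmenable_of_forall_eq_zero (hω : ∀ t, 1 ≤ ω t) {σ : GroupWeight G}
    (hσ : ω.IsAssociated σ) (hσb : BddAbove (Set.range fun t => σ t))
    (H : ∀ d : BeurlingAlgebra ω μ →L[ℂ] ℂ, IsPointDerivation augmentation d → d = 0) :
    IsTwoWeaklyAmenable (BeurlingAlgebra ω μ) := by
  intro D hD'
  have hD : ∀ a b F, D (a * b) F = D b (dualRight a F) + D a (dualRight b F) := fun a b F => by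
    rw [hD', bidualRight_eq_bidualLeft]
    rfl
  have h1 : ∀ b c F s, D (translate s b) (dualRight c F) = D b (dualRight (translate s c) F) :=
    fun b c F s => by
      have h := defect_mul_eq_zero hD hω H hσ hσb b (translate s c) F s
      rw [defect_mul hD, sub_eq_zero, translate_translate, neg_add_cancel,
        translate_zero] at h
      exact h
  have h2 : ∀ f b c F, D f (dualRight (c * b) F) = 0 := fun f b c F => by
    have e1 : D (f * b) (dualRight c F) = D b (dualRight (f * c) F) := by
      have l := map_mul_eq ((ContinuousLinearMap.apply ℂ ℂ (dualRight c F)).comp D) f b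
      have r := map_mul_eq ((D b).comp (dualRightL F)) f c
      change D (f * b) (dualRight c F) = ∫ t, f t • D (translate t b) (dualRight c F) ∂μ at l
      change D b (dualRight (f * c) F) = ∫ t, f t • D b (dualRight (translate t c) F) ∂μ at r
      rw [l, r]
      simp only [h1]
    rw [hD, dualRight_dualRight, dualRight_dualRight, BeurlingAlgebra.mul_comm c f] at e1
    simpa using e1
  have h3 : ∀ x y z w, D (x * y * (z * w)) = 0 := fun x y z w => by
    ext F
    rw [hD, h2, h2, add_zero]
    rfl
  have h4 : ∀ x z w, D (x * (z * w)) = 0 := fun x z w =>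
    eq_zero_of_forall_mul (L := fun x => D (x * (z * w))) (by fun_prop) (fun x y => h3 x y z w) x
  have h5 : ∀ x z, D (x * z) = 0 := fun x z =>
    eq_zero_of_forall_mul (L := fun z => D (x * z)) (by fun_prop) (fun z w => h4 x z w) z
  have h6 : ∀ x, D x = 0 := eq_zero_of_forall_mul D.continuous h5
  refine ⟨0, fun a => ?_⟩
  rw [h6, map_zero, map_zero]
  exact (sub_zero (0 : StrongDual ℂ (StrongDual ℂ (BeurlingAlgebra ω μ)))).symm

end BeurlingAlgebra

theorem theoremT {G : Type*} [AddCommGroup G] [TopologicalSpace G] [IsTopologicalAddGroup G]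
    [LocallyCompactSpace G] [T2Space G] [MeasurableSpace G] [BorelSpace G]
    (μ : Measure G) [μ.IsAddHaarMeasure] [μ.Regular]
    (ω : GroupWeight G) (hω : ∀ t, 1 ≤ ω t)
    (σ : GroupWeight G) (hσ : ω.IsAssociated σ) (hσb : BddAbove (Set.range fun t => σ t)) :
    (∀ d : BeurlingAlgebra ω μ →L[ℂ] ℂ,
        IsPointDerivation BeurlingAlgebra.augmentation d → d = 0) ↔
      IsTwoWeaklyAmenable (BeurlingAlgebra ω μ) :=
  ⟨BeurlingAlgebra.isTwoWeaklyAmenable_of_forall_eq_zero hω hσ hσb,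
    BeurlingAlgebra.eq_zero_of_isTwoWeaklyAmenable hω hσ hσb⟩
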